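/- **Definitions.** All systems are finite-dimensional. For a set $D$ in a vector space and a vector $x$, the *quasiprobability extent* is $$\gamma_D(x)=\inf\Big\{\sum_{i=1}^k|a_i| \;:\; x=\sum_{i=1}^k a_iF_i,\ k\ge 1,\ a_i\in\mathbb R,\ F_i\in D\Big\}\in[0,\infty],\qquad \inf\emptyset=\infty .$$ A *quantum instrument* is a countable family of completely positive maps whose sum is trace-preserving. A bipartite instrument is *one-way local* if it has the form $(\mathcal E_j\otimes\mathcal T_j)_j$ with $(\mathcal E_j)_j$ an instrument on one party's system and each $\mathcal T_j$ a channel on the other party's system. A coarse-graining of an instrument merges outcomes by adding the corresponding maps. An instrument is *LOCC-linked* to $(\mathcal E_j)_j$ if it is a coarse-graining of $(\mathcal F_{k|j}\circ\mathcal E_j)_{j,k}$, where $(\mathcal F_{k|j})_k$ is a one-way local instrument for every $j$. An *LOCC instrument* is an instrument $\mathcal I$ for which there are instruments $\mathcal I_0,\mathcal I_1,\dots$ (with intermediate local systems of any finite dimension), such that $\mathcal I_0$ is LOCC-linked to the identity, $\mathcal I_{r+1}$ is LOCC-linked to $\mathcal I_r$ for every $r$, and instruments $\mathcal J_r$, each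 obtained from $\mathcal I_r$ by outcome-dependent product channels to the output systems followed by a coarse-graining, converge to $\mathcal I$. The set $\mathrm{LOCC}$ consists of all channels $\sum_i\mathcal E_i$, and the set $\mathrm{LOCC}^\star$ of all maps $\sum_i\beta_i\mathcal E_i$ with $\beta_i\in[-1,1]$, where $(\mathcal E_i)_i$ ranges over the LOCC instruments (across the cut $A;B$). $\mathrm{SEP}(A;B)$ is the set of states $\sum_{i=1}^k p_i\,\rho_i\otimes\sigma_i$ with $(p_i)$ a probability vector and $\rho_i$, $\sigma_i$ density operators on $A$ and $B$. For a unitary $U$ on $AB$ let $\mathcal U(X)=UXU^\dagger$, and let $J(\mathcal U)=(\mathrm{id}\otimes\mathcal U)(|\Psi\rangle\langle\Psi|)$ be its Choi state, where $|\Psi\rangle=\dim(AB)^{-1/2}\sum_i|i\rangle\otimes|i\rangle$ is the maximally entangled state of $AB$ and a copy $A'B'$. A unitary $U$ on $N$ qubits is *Clifford* if $UQU^\dagger$ is in the $N$-qubit Pauli group $\{i^cQ_1\otimes\dots\otimes Q_N : 0\le c\le 3,\ Q_k\in\{\mathbb 1,X,Y,Z\}\}$ whenever $Q$ is. **Statement.**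 Let $A$ and $B$ be systems of $n$ and $m$ qubits. For any bipartite Clifford unitary $U$ on $AB$ (that is, a Clifford unitary on all $n+m$ qubits), $$\gamma_{\mathrm{LOCC}^\star}(\mathcal U)=\gamma_{\mathrm{LOCC}}(\mathcal U)=\gamma_{\mathrm{SEP}(AA';BB')}\big(J(\mathcal U)\big).$$ Moreover, for the two-qubit gates $\mathrm{CNOT}$, $\mathrm{SWAP}$ and $\mathrm{iSWAP}$, with one qubit on each side, $$\gamma_{\mathrm{LOCC}^\star}(\mathrm{CNOT})=3,\qquad \gamma_{\mathrm{LOCC}^\star}(\mathrm{SWAP})=\gamma_{\mathrm{LOCC}^\star}(\mathrm{iSWAP})=7 .$$ -/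

import Mathlib

open scoped Matrix Kronecker ComplexOrder Topology ENNReal

noncomputable section

namespace CircuitKnitting

/-! ### Systems, states and superoperators

A quantum system is given by a finite type indexing an orthonormal basis of its Hilbert space; the
joint system of `a` and `b` is `a × b`. -/

/-- A finite-dimensional quantum system (used for the intermediate systems of a protocol). -/
structure Sys where
  carrier : Type
  [fin : Fintype carrier]
  [dec : DecidableEq carrier]

attribute [instance] Sys.fin Sys.dec

/-- Linear superoperators from `a` to `b`. -/
abbrev SuperOp (a b : Type) : Type := Matrix a a ℂ →ₗ[ℂ] Matrix b b ℂ

/-- Density operators. -/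
def IsDensity {a : Type} [Fintype a] (ρ : Matrix a a ℂ) : Prop :=
  ρ.PosSemidef ∧ ρ.trace = 1

/-- The tensor product `Φ ⊗ Ψ` of superoperators: `Φ` acts on the blocks of the first factor, and
then `Ψ` acts on those of the second one. -/
def tensorMap {a a' b b' : Type} (Φ : SuperOp a a') (Ψ : SuperOp b b') :
    SuperOp (a × b) (a' × b') where
  toFun X := Matrix.of fun p q =>
    Ψ (Matrix.of fun k l => Φ (Matrix.of fun i j => X (i, k) (j, l)) p.1 q.1) p.2 q.2
  map_add' X Y := by
    have h1 : ∀ k l, Φ (Matrix.of fun i j => (X + Y) (i, k) (j, l))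
        = Φ (Matrix.of fun i j => X (i, k) (j, l)) + Φ (Matrix.of fun i j => Y (i, k) (j, l)) :=
      fun _ _ => map_add Φ _ _
    ext p q
    simp only [h1]
    exact congrFun (congrFun (map_add Ψ _ _) p.2) q.2
  map_smul' c X := by
    have h1 : ∀ k l, Φ (Matrix.of fun i j => (c • X) (i, k) (j, l))
        = c • Φ (Matrix.of fun i j => X (i, k) (j, l)) := fun _ _ => map_smul Φ c _
    ext p q
    simp only [h1]
    exact congrFun (congrFun (map_smul Ψ c _) p.2) q.2

/-- Complete positivity: `Φ ⊗ id` is positive for every auxiliary system. -/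
def IsCP {a b : Type} [Fintype a] [Fintype b] (Φ : SuperOp a b) : Prop :=
  ∀ (k : ℕ) (X : Matrix (a × Fin k) (a × Fin k) ℂ), X.PosSemidef →
    (tensorMap Φ (LinearMap.id : SuperOp (Fin k) (Fin k)) X).PosSemidef

/-- Trace preservation. -/
def IsTP {a b : Type} [Fintype a] [Fintype b] (Φ : SuperOp a b) : Prop :=
  ∀ X, (Φ X).trace = X.trace

/-- Quantum channels. -/
def IsChannel {a b : Type} [Fintype a] [Fintype b] (Φ : SuperOp a b) : Prop :=
  IsCP Φ ∧ IsTP Φ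

/-- The superoperator `X ↦ U X U†` induced by an operator `U`. -/
def inducedMap {a : Type} [Fintype a] (U : Matrix a a ℂ) : SuperOp a a where
  toFun X := U * X * Uᴴ
  map_add' X Y := by simp [mul_add, add_mul]
  map_smul' c X := by simp

/-- The maximally entangled vector `d ^ (-1/2) ∑ i, |i⟩ ⊗ |i⟩` of a system and a copy of it. -/
def maxEntangled (a : Type) [Fintype a] [DecidableEq a] : a × a → ℂ :=
  fun p => if p.1 = p.2 then ((√(Fintype.card a : ℝ))⁻¹ : ℝ) else 0

/-- The (normalised) Choi operator `(id ⊗ Φ)(|Ψ⟩⟨Ψ|)`. -/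
def choi {a b : Type} [Fintype a] [DecidableEq a] (Φ : SuperOp a b) :
    Matrix (a × b) (a × b) ℂ :=
  tensorMap (LinearMap.id : SuperOp a a) Φ
    (Matrix.vecMulVec (maxEntangled a) (star (maxEntangled a)))

/-- The Choi operator of a bipartite superoperator from `A;B` to `A';B'`, with its four systems
ordered as `(A A') (B B')`. -/
def bipartiteChoi {a b a' b' : Type} [Fintype a] [DecidableEq a] [Fintype b] [DecidableEq b]
    (Φ : SuperOp (a × b) (a' × b')) : Matrix ((a × a') × (b × b')) ((a × a') × (b × b')) ℂ :=
  Matrix.reindex (Equiv.prodProdProdComm a b a' b') (Equiv.prodProdProdComm a b a' b') (choi Φ)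

/-- Separable states across `a` and `b`. -/
def SEP (a b : Type) [Fintype a] [Fintype b] : Set (Matrix (a × b) (a × b) ℂ) :=
  {ω | ∃ (m : ℕ) (p : Fin m → ℝ) (ρ : Fin m → Matrix a a ℂ) (σ : Fin m → Matrix b b ℂ),
    (∀ i, 0 ≤ p i) ∧ ∑ i, p i = 1 ∧ (∀ i, IsDensity (ρ i)) ∧ (∀ i, IsDensity (σ i)) ∧
    ω = ∑ i, (p i : ℂ) • (ρ i ⊗ₖ σ i)}

/-! ### Quasiprobability extent -/

/-- The quasiprobability extent of `x` with respect to the decomposition set `D`: the infimum of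
`∑ |a i|` over all finite decompositions `x = ∑ a i • F i` with real `a i` and `F i ∈ D`
(and `∞` if there is none). -/
def gamma {V : Type*} [AddCommGroup V] [Module ℂ V] (D : Set V) (x : V) : ℝ≥0∞ :=
  sInf {r | ∃ (m : ℕ) (a : Fin m → ℝ) (F : Fin m → V), 1 ≤ m ∧ (∀ i, F i ∈ D) ∧
    x = ∑ i, (a i : ℂ) • F i ∧ r = ENNReal.ofReal (∑ i, |a i|)}

/-! ### Quantum instruments -/

/-- `Φ` is the sum of the family `E` (pointwise unconditional convergence, which in finite
dimensions is convergence in any norm). -/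
def IsSum {a b Θ : Type} (E : Θ → SuperOp a b) (Φ : SuperOp a b) : Prop :=
  ∀ X, HasSum (fun θ => E θ X) (Φ X)

/-- Quantum instruments: countable families of completely positive maps whose sum is
trace-preserving. (Zero members are harmless, and allowed.) -/
def IsInstrument {a b Θ : Type} [Fintype a] [Fintype b] (E : Θ → SuperOp a b) : Prop :=
  Countable Θ ∧ (∀ θ, IsCP (E θ)) ∧ ∃ Φ : SuperOp a b, IsTP Φ ∧ IsSum E Φ

/-- `F` is a coarse-graining of `E`: classical outcomes are merged along some map `f`. -/
def IsCoarseGraining {a b Θ Λ : Type} (E : Θ → SuperOp a b) (F : Λ → SuperOp a b) : Prop :=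
  ∃ f : Θ → Λ, ∀ l, IsSum (fun θ : {θ // f θ = l} => E θ) (F l)

/-- The decomposition set of the channels `∑ i, E i`, for `E` in a class `Q` of instruments. -/
def marginalChannels {a b : Type} (Q : ∀ Θ : Type, Set (Θ → SuperOp a b)) : Set (SuperOp a b) :=
  {Φ | ∃ (Θ : Type) (E : Θ → SuperOp a b), E ∈ Q Θ ∧ IsSum E Φ}

/-- The decomposition set with classical side information, which consists of the maps
`∑ i, β i • E i` with `β i ∈ [-1, 1]`, for `E` in a class `Q` of instruments. -/
def sideInfo {a b : Type} (Q : ∀ Θ : Type, Set (Θ → SuperOp a b)) : Set (SuperOp a b) :=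
  {Φ | ∃ (Θ : Type) (E : Θ → SuperOp a b) (β : Θ → ℝ), E ∈ Q Θ ∧
    (∀ θ, β θ ∈ Set.Icc (-1 : ℝ) 1) ∧ IsSum (fun θ => (β θ : ℂ) • E θ) Φ}

/-! ### Local operations and classical communication -/

section LOCC

variable {a b a' b' a'' b'' : Type} [Fintype a] [Fintype b] [Fintype a'] [Fintype b']
  [Fintype a''] [Fintype b'']

/-- Products of local channels. -/
def IsLocalChannel (F : SuperOp (a × b) (a' × b')) : Prop :=
  ∃ (S : SuperOp a a') (T : SuperOp b b'), IsChannel S ∧ IsChannel T ∧ F = tensorMap S T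

/-- One-way local instruments: one of the two parties applies an instrument and announces the
outcome; the other party then applies a channel depending on that outcome. -/
def IsOneWayLocal {Θ : Type} (F : Θ → SuperOp (a × b) (a' × b')) : Prop :=
  (∃ (E : Θ → SuperOp a a') (T : Θ → SuperOp b b'),
    IsInstrument E ∧ (∀ θ, IsChannel (T θ)) ∧ ∀ θ, F θ = tensorMap (E θ) (T θ)) ∨
  (∃ (T : Θ → SuperOp a a') (E : Θ → SuperOp b b'),
    (∀ θ, IsChannel (T θ)) ∧ IsInstrument E ∧ ∀ θ, F θ = tensorMap (T θ) (E θ))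

/-- `J` is LOCC-linked to `I`: it arises from `I` by one more round, i.e. by a one-way local
instrument chosen depending on the outcome of `I`, followed by a coarse-graining. -/
def LOCCLinked {s Θ Λ : Type} (I : Θ → SuperOp s (a × b)) (J : Λ → SuperOp s (a' × b')) : Prop :=
  ∃ (Ξ : Θ → Type) (F : ∀ θ, Ξ θ → SuperOp (a × b) (a' × b')),
    (∀ θ, IsOneWayLocal (F θ)) ∧
    IsCoarseGraining (fun p : Σ θ, Ξ θ => (F p.1 p.2).comp (I p.1)) J

/-- LOCC instruments with an unbounded number of rounds. There is a protocol
`I 0, I 1, …`, each round linked to the previous one, with intermediate local systems of any finite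
dimension, such that the instruments `J r`, obtained by stopping after round `r` (outcome-dependent
local channels to the output systems, and a coarse-graining), converge to the instrument `E`.
(As `E` is an instrument too, so that no weight is lost in the limit, outcome-wise convergence is
the same as convergence of the associated quantum-to-classical-quantum channels.) A protocol with
finitely many rounds is one in which nothing happens after some round. -/
def LOCCInstr (a b a' b' : Type) [Fintype a] [Fintype b] [Fintype a'] [Fintype b'] (Θ : Type) :
    Set (Θ → SuperOp (a × b) (a' × b')) :=
  {E | IsInstrument E ∧
    ∃ (A B : ℕ → Sys) (Ξ : ℕ → Type)
      (I : ∀ r, Ξ r → SuperOp (a × b) ((A r).carrier × (B r).carrier))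
      (D : ∀ r, Ξ r → SuperOp ((A r).carrier × (B r).carrier) (a' × b'))
      (J : ℕ → Θ → SuperOp (a × b) (a' × b')),
      LOCCLinked (fun _ : Unit => (LinearMap.id : SuperOp (a × b) (a × b))) (I 0) ∧
      (∀ r, LOCCLinked (I r) (I (r + 1))) ∧
      (∀ r ξ, IsLocalChannel (D r ξ)) ∧
      (∀ r, IsCoarseGraining (fun ξ => (D r ξ).comp (I r ξ)) (J r)) ∧
      ∀ θ X, Filter.Tendsto (fun r => J r θ X) Filter.atTop (𝓝 (E θ X))}

end LOCC

/-- The set `LOCC(A;B → A;B)` of channels. -/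
def LOCC (a b : Type) [Fintype a] [Fintype b] : Set (SuperOp (a × b) (a × b)) :=
  marginalChannels (LOCCInstr a b a b)

/-- The set `LOCC⋆(A;B → A;B)`: LOCC with classical side information. -/
def LOCCStar (a b : Type) [Fintype a] [Fintype b] : Set (SuperOp (a × b) (a × b)) :=
  sideInfo (LOCCInstr a b a b)

/-! ### Qubits and the Clifford group -/

/-- Basis labels of a register of qubits indexed by `ι`. -/
abbrev Bits (ι : Type) : Type := ι → Fin 2

/-- The Pauli matrices `1, X, Y, Z`. -/
def pauli : Fin 4 → Matrix (Fin 2) (Fin 2) ℂ :=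
  ![1, !![0, 1; 1, 0], !![0, -Complex.I; Complex.I, 0], !![1, 0; 0, -1]]

/-- The tensor product of the Pauli matrices `pauli (Q k)`. -/
def pauliString {ι : Type} [Fintype ι] (Q : ι → Fin 4) : Matrix (Bits ι) (Bits ι) ℂ :=
  Matrix.of fun x y => ∏ k, pauli (Q k) (x k) (y k)

/-- The Pauli group. -/
def pauliGroup (ι : Type) [Fintype ι] : Set (Matrix (Bits ι) (Bits ι) ℂ) :=
  {P | ∃ (c : Fin 4) (Q : ι → Fin 4), P = Complex.I ^ (c : ℕ) • pauliString Q}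

/-- The Clifford group. -/
def cliffordGroup (ι : Type) [Fintype ι] [DecidableEq ι] : Set (Matrix (Bits ι) (Bits ι) ℂ) :=
  {U | U ∈ Matrix.unitaryGroup (Bits ι) ℂ ∧ ∀ P ∈ pauliGroup ι, U * P * Uᴴ ∈ pauliGroup ι}

/-- An operator on the joint system of an `n`-qubit and an `m`-qubit system is a bipartite
Clifford unitary if it is a Clifford unitary on the register of all `n + m` qubits. -/
def IsBipartiteClifford {n m : ℕ}
    (U : Matrix (Bits (Fin n) × Bits (Fin m)) (Bits (Fin n) × Bits (Fin m)) ℂ) : Prop :=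
  Matrix.reindex (Equiv.sumArrowEquivProdArrow (Fin n) (Fin m) (Fin 2)).symm
    (Equiv.sumArrowEquivProdArrow (Fin n) (Fin m) (Fin 2)).symm U
    ∈ cliffordGroup (Fin n ⊕ Fin m)

/-- The two-qubit gate (one qubit on each side) whose matrix in the basis
`|00⟩, |01⟩, |10⟩, |11⟩` is `M`. -/
def twoQubitGate (M : Matrix (Fin 4) (Fin 4) ℂ) :
    Matrix (Bits (Fin 1) × Bits (Fin 1)) (Bits (Fin 1) × Bits (Fin 1)) ℂ :=
  Matrix.of fun x y => M (finProdFinEquiv (x.1 0, x.2 0)) (finProdFinEquiv (y.1 0, y.2 0))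

def CNOT : Matrix (Bits (Fin 1) × Bits (Fin 1)) (Bits (Fin 1) × Bits (Fin 1)) ℂ :=
  twoQubitGate !![1, 0, 0, 0; 0, 1, 0, 0; 0, 0, 0, 1; 0, 0, 1, 0]

def SWAP : Matrix (Bits (Fin 1) × Bits (Fin 1)) (Bits (Fin 1) × Bits (Fin 1)) ℂ :=
  twoQubitGate !![1, 0, 0, 0; 0, 0, 1, 0; 0, 1, 0, 0; 0, 0, 0, 1]

def iSWAP : Matrix (Bits (Fin 1) × Bits (Fin 1)) (Bits (Fin 1) × Bits (Fin 1)) ℂ :=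
  twoQubitGate !![1, 0, 0, 0; 0, 0, Complex.I, 0; 0, Complex.I, 0, 0; 0, 0, 0, 1]

end CircuitKnitting

end

open CircuitKnitting

noncomputable section

namespace CircuitKnitting

/-! ### Quasiprobability extent -/

/-! The three extents of a Clifford gate agree by a cycle of inequalities. Constant coefficients `β
= 1` give `LOCC ⊆ LOCCStar`, so the extent over `LOCCStar` is at most the one over `LOCC`. The other
two steps compare maps with their Choi operators.

From maps to states (`gamma_SEP_le_gamma_LOCCStar`): local completely positive maps act locally on
the Choi operator across `AA';BB'`, so every finite stage of a protocol has Choi operators in the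
cone of separable operators. This cone is closed, because it is generated by a compact set of trace
one; hence infinite sums of outcomes and limits over rounds stay in it. Splitting the coefficients
`β` into positive and negative parts writes the Choi operator of an element of `LOCCStar` as `P - N`
with `P`, `N` separable and total trace at most one, so a decomposition of the gate becomes one of
its Choi state at no extra cost.

From states to maps (`gamma_LOCC_le_gamma_SEP`): gate teleportation. A linear map `Λ` turns a
four-party operator into the superoperator obtained by teleporting through it. The Pauli errors `P ⊗
Q` caused by the measurement outcomes are pushed through `U`; since `U (P ⊗ Q) U†` is a product `V ⊗
W`, the parties undo it locally after exchanging outcomes. So `Λ` sends the Choi state of `U` to `U`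
itself and product states to LOCC channels. Only this product property is used, and a Clifford
unitary has it because a Pauli string factors across the cut.

For the three gates, the Choi state has `k` equal Schmidt coefficients, with `k = 2` for CNOT and `k
= 4` for SWAP and iSWAP. Its extent is `2 k - 1` (`gamma_schmidtState`): averaging product vectors
over random phases gives the upper bound, and the overlap with the unnormalised maximally entangled
vector, which lies in `[0, 1]` on separable states and equals `k` on this state, gives the lower
one. -/

lemma gamma_le_of_sum {V : Type*} [AddCommGroup V] [Module ℂ V] {D : Set V} {x : V}
    {ι : Type*} [Fintype ι] [Nonempty ι] (a : ι → ℝ) (F : ι → V) (hF : ∀ i, F i ∈ D)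
    (hx : x = ∑ i, (a i : ℂ) • F i) {r : ℝ} (hr : ∑ i, |a i| ≤ r) :
    gamma D x ≤ ENNReal.ofReal r := by
  refine (sInf_le ?_).trans (ENNReal.ofReal_le_ofReal hr)
  let e := Fintype.equivFin ι
  refine ⟨Fintype.card ι, a ∘ e.symm, F ∘ e.symm, Fintype.card_pos, fun i => hF _, ?_, ?_⟩
  · rw [hx]
    exact (Equiv.sum_comp e.symm (fun i => (a i : ℂ) • F i)).symm
  · congr 1
    exact (Equiv.sum_comp e.symm (fun i => |a i|)).symm

lemma gamma_le_gamma {V W : Type*} [AddCommGroup V] [Module ℂ V] [AddCommGroup W] [Module ℂ W]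
    {D : Set V} {x : V} {D' : Set W} {x' : W}
    (h : ∀ (m : ℕ) (a : Fin m → ℝ) (F : Fin m → V), 1 ≤ m → (∀ i, F i ∈ D) →
      x = ∑ i, (a i : ℂ) • F i → gamma D' x' ≤ ENNReal.ofReal (∑ i, |a i|)) :
    gamma D' x' ≤ gamma D x := by
  refine le_sInf ?_
  rintro r ⟨m, a, F, hm, hF, hx, rfl⟩
  exact h m a F hm hF hx

lemma gamma_mono {V : Type*} [AddCommGroup V] [Module ℂ V] {D D' : Set V} (h : D ⊆ D') (x : V) :
    gamma D' x ≤ gamma D x := by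
  refine gamma_le_gamma fun m a F hm hF hx => ?_
  have : Nonempty (Fin m) := ⟨⟨0, hm⟩⟩
  exact gamma_le_of_sum a F (fun i => h (hF i)) hx le_rfl

/-! ### Superoperators and their Choi operators -/

section Choi

variable {a b a' b' a'' b'' c : Type}

lemma tensorMap_apply (Φ : SuperOp a a') (Ψ : SuperOp b b') (X : Matrix (a × b) (a × b) ℂ)
    (p q : a' × b') :
    tensorMap Φ Ψ X p q = Ψ (Matrix.of fun k l => Φ (Matrix.of fun i j => X (i, k) (j, l)) p.1 q.1)
      p.2 q.2 := rfl

lemma tensorMap_kronecker (Φ : SuperOp a a') (Ψ : SuperOp b b') (x : Matrix a a ℂ)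
    (y : Matrix b b ℂ) : tensorMap Φ Ψ (x ⊗ₖ y) = Φ x ⊗ₖ Ψ y := by
  ext p q
  have h : ∀ k l, (Matrix.of fun i j => (x ⊗ₖ y) (i, k) (j, l)) = y k l • x := by
    intro k l
    ext i j
    simp [Matrix.kroneckerMap_apply, mul_comm]
  have h2 : (Matrix.of fun k l => (y k l • Φ x) p.1 q.1) = Φ x p.1 q.1 • y := by
    ext k l
    simp [mul_comm]
  rw [tensorMap_apply]
  simp only [h, map_smul, h2]
  simp [Matrix.kroneckerMap_apply]

lemma tensorMap_id_id : tensorMap (LinearMap.id : SuperOp a a) (LinearMap.id : SuperOp b b)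
    = LinearMap.id := by
  ext X
  rfl

/-- Matrix units of the joint system are Kronecker products, so product operators span. This reduces
most identities between bipartite superoperators to `tensorMap_kronecker`. -/
lemma linearMap_ext_kronecker [Fintype a] [DecidableEq a] [Fintype b] [DecidableEq b]
    {V : Type*} [AddCommMonoid V] [Module ℂ V] {Φ Ψ : Matrix (a × b) (a × b) ℂ →ₗ[ℂ] V}
    (h : ∀ x y, Φ (x ⊗ₖ y) = Ψ (x ⊗ₖ y)) : Φ = Ψ := by
  refine Matrix.ext_linearMap ℂ (fun p q => ?_)
  ext1
  have hs : Matrix.single p q (1 : ℂ) = Matrix.single p.1 q.1 1 ⊗ₖ Matrix.single p.2 q.2 1 := by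
    rw [Matrix.single_kronecker_single]
    simp
  change Φ (Matrix.single p q 1) = Ψ (Matrix.single p q 1)
  rw [hs, h]

variable [Fintype a] [DecidableEq a] [Fintype b] [DecidableEq b]

lemma tensorMap_comp (Φ : SuperOp a a') (Ψ : SuperOp b b') (Φ' : SuperOp a' a'')
    (Ψ' : SuperOp b' b'') :
    (tensorMap Φ' Ψ').comp (tensorMap Φ Ψ) = tensorMap (Φ'.comp Φ) (Ψ'.comp Ψ) :=
  linearMap_ext_kronecker fun x y => by
    simp only [LinearMap.comp_apply, tensorMap_kronecker]

lemma choi_apply (Φ : SuperOp a c) (p q : a × c) :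
    choi Φ p q = (Fintype.card a : ℂ)⁻¹ * Φ (Matrix.single p.1 q.1 1) p.2 q.2 := by
  have h : (Matrix.of fun k l => (Matrix.vecMulVec (maxEntangled a) (star (maxEntangled a)))
      (p.1, k) (q.1, l)) = (Fintype.card a : ℂ)⁻¹ • Matrix.single p.1 q.1 (1 : ℂ) := by
    ext k l
    have hs : ((√(Fintype.card a : ℝ) : ℝ) : ℂ)⁻¹ * ((√(Fintype.card a : ℝ) : ℝ) : ℂ)⁻¹
        = (Fintype.card a : ℂ)⁻¹ := by
      rw [← mul_inv, ← Complex.ofReal_mul, Real.mul_self_sqrt (Nat.cast_nonneg _)]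
      simp
    by_cases h1 : p.1 = k <;> by_cases h2 : q.1 = l <;>
      simp [Matrix.vecMulVec_apply, maxEntangled, Matrix.single, h1, h2, hs]
  rw [choi, tensorMap_apply]
  refine (congrFun (congrFun (congrArg Φ h) p.2) q.2).trans ?_
  rw [map_smul]
  rfl

lemma bipartiteChoi_apply (Φ : SuperOp (a × b) (a' × b')) (p q : (a × a') × (b × b')) :
    bipartiteChoi Φ p q = (Fintype.card (a × b) : ℂ)⁻¹ *
      Φ (Matrix.single (p.1.1, p.2.1) (q.1.1, q.2.1) 1) (p.1.2, p.2.2) (q.1.2, q.2.2) := by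
  simp only [bipartiteChoi, Matrix.reindex_apply, Matrix.submatrix_apply, choi_apply]
  rfl

lemma bipartiteChoi_smul (r : ℂ) (F : SuperOp (a × b) (a' × b')) :
    bipartiteChoi (r • F) = r • bipartiteChoi F := by
  ext p q
  simp only [bipartiteChoi_apply, LinearMap.smul_apply, Matrix.smul_apply, smul_eq_mul]
  ring

lemma bipartiteChoi_sum_smul {ι : Type*} [Fintype ι] (r : ι → ℂ)
    (F : ι → SuperOp (a × b) (a' × b')) :
    bipartiteChoi (∑ i, r i • F i) = ∑ i, r i • bipartiteChoi (F i) := by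
  ext p q
  simp only [bipartiteChoi_apply, LinearMap.sum_apply, LinearMap.smul_apply, Matrix.sum_apply,
    Matrix.smul_apply, smul_eq_mul, Finset.mul_sum]
  exact Finset.sum_congr rfl fun i _ => by ring

lemma hasSum_bipartiteChoi {Θ : Type} {E : Θ → SuperOp (a × b) (a' × b')}
    {Φ : SuperOp (a × b) (a' × b')} (h : IsSum E Φ) :
    HasSum (fun θ => bipartiteChoi (E θ)) (bipartiteChoi Φ) := by
  refine Pi.hasSum.2 fun p => Pi.hasSum.2 fun q => ?_
  simp only [bipartiteChoi_apply]
  exact ((Pi.hasSum.1 (Pi.hasSum.1 (h _) _) _)).mul_left _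

lemma tendsto_bipartiteChoi {J : ℕ → SuperOp (a × b) (a' × b')} {Φ : SuperOp (a × b) (a' × b')}
    (h : ∀ X, Filter.Tendsto (fun r => J r X) Filter.atTop (𝓝 (Φ X))) :
    Filter.Tendsto (fun r => bipartiteChoi (J r)) Filter.atTop (𝓝 (bipartiteChoi Φ)) := by
  refine tendsto_pi_nhds.2 fun p => tendsto_pi_nhds.2 fun q => ?_
  simp only [bipartiteChoi_apply]
  exact (tendsto_pi_nhds.1 (tendsto_pi_nhds.1 (h _) _) _).const_mul _

lemma bipartiteChoi_tensorMap (S : SuperOp a a') (T : SuperOp b b') :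
    bipartiteChoi (tensorMap S T) = choi S ⊗ₖ choi T := by
  ext p q
  have : Matrix.single (p.1.1, p.2.1) (q.1.1, q.2.1) (1 : ℂ)
      = Matrix.single p.1.1 q.1.1 1 ⊗ₖ Matrix.single p.2.1 q.2.1 1 := by
    rw [Matrix.single_kronecker_single]
    simp
  rw [bipartiteChoi_apply, this, tensorMap_kronecker]
  simp only [Matrix.kroneckerMap_apply, choi_apply, Fintype.card_prod, Nat.cast_mul, mul_inv]
  ring

/-- Post-processing touches only the output halves `A'` and `B'`; across the cut `AA';BB'` it is
again a tensor product of local maps. This is why local operations preserve separability of the Choi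
operator. -/
lemma bipartiteChoi_comp (Φ : SuperOp (a × b) (a' × b')) (S : SuperOp a' a'') (T : SuperOp b' b'') :
    bipartiteChoi ((tensorMap S T).comp Φ)
      = tensorMap (tensorMap (LinearMap.id : SuperOp a a) S)
          (tensorMap (LinearMap.id : SuperOp b b) T) (bipartiteChoi Φ) := by
  ext p q
  rw [bipartiteChoi_apply, LinearMap.comp_apply, tensorMap_apply, tensorMap_apply, tensorMap_apply]
  simp only [tensorMap_apply, LinearMap.id_apply, Matrix.of_apply]
  have : ∀ k l : b', (Matrix.of fun k_1 l_1 : a' => Matrix.of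
      (fun i j : a × a' => bipartiteChoi Φ (i, (p.2.1, k)) (j, (q.2.1, l)))
        (p.1.1, k_1) (q.1.1, l_1)) = (Fintype.card (a × b) : ℂ)⁻¹ • (Matrix.of fun i j =>
        Φ (Matrix.single (p.1.1, p.2.1) (q.1.1, q.2.1) 1) (i, k) (j, l)) := by
    intro k l
    ext i j
    simp [bipartiteChoi_apply]
  simp only [Matrix.of_apply] at this
  simp only [this, map_smul]
  have h2 : ∀ M : Matrix b' b' ℂ, (Fintype.card (a × b) : ℂ)⁻¹ * T M p.2.2 q.2.2
      = T ((Fintype.card (a × b) : ℂ)⁻¹ • M) p.2.2 q.2.2 := fun M => by simp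
  rw [h2]
  rfl

lemma trace_bipartiteChoi_of_isTP [Nonempty a] [Nonempty b] [Fintype a'] [Fintype b']
    {Φ : SuperOp (a × b) (a' × b')} (h : IsTP Φ) : (bipartiteChoi Φ).trace = 1 := by
  have h1 : (bipartiteChoi Φ).trace = ∑ p : a × b, (Fintype.card (a × b) : ℂ)⁻¹ *
      (Φ (Matrix.single p p 1)).trace := by
    simp only [Matrix.trace, Matrix.diag_apply, Finset.mul_sum, ← Fintype.sum_prod_type']
    rw [← Equiv.sum_comp (Equiv.prodProdProdComm a b a' b')]
    exact Finset.sum_congr rfl fun x _ => bipartiteChoi_apply _ _ _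
  rw [h1]
  simp only [h _, Matrix.trace_single_eq_same, mul_one, Finset.sum_const, Finset.card_univ,
    nsmul_eq_mul]
  exact mul_inv_cancel₀ (by simp)

end Choi

/-! ### Superoperators built from operators -/

section OfChoi

variable {a b : Type} [Fintype a]

/-- The superoperator whose unnormalised Choi operator is `ω`. -/
def ofChoi (ω : Matrix (a × b) (a × b) ℂ) : SuperOp a b where
  toFun X := Matrix.of fun k l => ∑ p : a × a, X p.1 p.2 * ω (p.1, k) (p.2, l)
  map_add' X Y := by
    ext k l
    simp [add_mul, Finset.sum_add_distrib]
  map_smul' r X := by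
    ext k l
    simp [Finset.mul_sum, mul_assoc]

lemma ofChoi_apply (ω : Matrix (a × b) (a × b) ℂ) (X : Matrix a a ℂ) (k l : b) :
    ofChoi ω X k l = ∑ p : a × a, X p.1 p.2 * ω (p.1, k) (p.2, l) := rfl

end OfChoi

/-! ### Complete positivity -/

section CP

variable {a b c a' b' : Type} [Fintype a] [Fintype b] [Fintype c]

lemma isCP_id : IsCP (LinearMap.id : SuperOp a a) := fun _ _ hX => hX

lemma isChannel_id : IsChannel (LinearMap.id : SuperOp a a) := ⟨isCP_id, fun _ => rfl⟩

lemma IsCP.comp {Ψ : SuperOp b c} {Φ : SuperOp a b} (hΨ : IsCP Ψ) (hΦ : IsCP Φ) :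
    IsCP (Ψ.comp Φ) := fun k X hX => hΨ k _ (hΦ k X hX)

lemma IsCP.smul {Φ : SuperOp a b} (hΦ : IsCP Φ) {r : ℝ} (hr : 0 ≤ r) : IsCP ((r : ℂ) • Φ) := by
  intro k X hX
  have : tensorMap ((r : ℂ) • Φ) (LinearMap.id : SuperOp (Fin k) (Fin k)) X
      = (r : ℂ) • tensorMap Φ (LinearMap.id : SuperOp (Fin k) (Fin k)) X := by
    ext p q
    rfl
  rw [this]
  exact (hΦ k X hX).smul (by exact_mod_cast hr)

lemma IsCP.posSemidef_id_tensorMap {Φ : SuperOp a b} (hΦ : IsCP Φ)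
    {X : Matrix (c × a) (c × a) ℂ} (hX : X.PosSemidef) :
    (tensorMap (LinearMap.id : SuperOp c c) Φ X).PosSemidef := by
  let e := Fintype.equivFin c
  have h := hΦ _ _ (hX.submatrix (fun p : a × Fin (Fintype.card c) => (e.symm p.2, p.1)))
  have h2 := h.submatrix (fun p : c × b => (p.2, e p.1))
  convert h2 using 1
  ext p q
  simp [tensorMap_apply]

lemma IsCP.posSemidef_choi [DecidableEq a] {Φ : SuperOp a b} (hΦ : IsCP Φ) :
    (choi Φ).PosSemidef :=
  hΦ.posSemidef_id_tensorMap (Matrix.posSemidef_vecMulVec_self_star _)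

/-- The output is a compression of `X ⊗ ω`: the two copies of the input index are identified and
then summed, and both operations preserve positivity. -/
lemma isCP_ofChoi {ω : Matrix (a × b) (a × b) ℂ} (hω : ω.PosSemidef) : IsCP (ofChoi ω) := by
  classical
  intro k X hX
  -- The submatrix identifies the input indices of `X` and `ω`; conjugation by the 0/1 matrix sums
  -- over the common index, independently for rows and columns.
  have h := ((hX.kronecker hω).submatrix
    (fun p : a × (b × Fin k) => ((p.1, p.2.2), (p.1, p.2.1)))).conjTranspose_mul_mul_same
    (Matrix.of fun (p : a × (b × Fin k)) (q : b × Fin k) => if p.2 = q then (1 : ℂ) else 0)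
  refine (congrArg Matrix.PosSemidef ?_).mpr h
  ext p q
  simp only [tensorMap_apply, LinearMap.id_apply, Matrix.of_apply, ofChoi_apply, Matrix.mul_apply,
    Matrix.conjTranspose_apply, Matrix.submatrix_apply, Matrix.kroneckerMap_apply]
  rw [Fintype.sum_prod_type, Fintype.sum_prod_type, Finset.sum_comm]
  refine Finset.sum_congr rfl fun j _ => ?_
  rw [Finset.sum_eq_single q (fun y _ hy => by simp [hy]) (by simp), if_pos rfl, mul_one,
    Fintype.sum_prod_type]
  refine Finset.sum_congr rfl fun i _ => ?_
  rw [Finset.sum_eq_single p (fun y _ hy => by simp [hy]) (by simp)]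
  simp

lemma trace_ofChoi (ω : Matrix (a × b) (a × b) ℂ) (X : Matrix a a ℂ) :
    (ofChoi ω X).trace = ∑ p : a × a, X p.1 p.2 * ∑ k, ω (p.1, k) (p.2, k) := by
  simp only [Matrix.trace, Matrix.diag_apply, ofChoi_apply]
  rw [Finset.sum_comm]
  simp only [Finset.mul_sum]

lemma isCP_inducedMap (U : Matrix a a ℂ) : IsCP (inducedMap U) := by
  classical
  intro k X hX
  have h := hX.mul_mul_conjTranspose_same (U ⊗ₖ (1 : Matrix (Fin k) (Fin k) ℂ))
  have h2 : tensorMap (inducedMap U) (LinearMap.id : SuperOp (Fin k) (Fin k))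
      = inducedMap (U ⊗ₖ (1 : Matrix (Fin k) (Fin k) ℂ)) := by
    refine linearMap_ext_kronecker fun x y => ?_
    rw [tensorMap_kronecker]
    simp [inducedMap, Matrix.conjTranspose_kronecker, ← Matrix.mul_kronecker_mul]
  rw [h2]
  exact h

lemma isChannel_inducedMap [DecidableEq a] {U : Matrix a a ℂ} (hU : Uᴴ * U = 1) :
    IsChannel (inducedMap U) := by
  refine ⟨isCP_inducedMap U, fun X => ?_⟩
  change (U * X * Uᴴ).trace = _
  rw [Matrix.trace_mul_comm, ← mul_assoc, hU, one_mul]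

lemma tensorMap_inducedMap [DecidableEq a] [DecidableEq b] (U : Matrix a a ℂ) (V : Matrix b b ℂ) :
    tensorMap (inducedMap U) (inducedMap V) = inducedMap (U ⊗ₖ V) := by
  refine linearMap_ext_kronecker fun x y => ?_
  rw [tensorMap_kronecker]
  simp [inducedMap, Matrix.conjTranspose_kronecker, ← Matrix.mul_kronecker_mul]

end CP

/-! ### The cone of separable operators -/

section SepCone

variable {a b : Type}

variable (a b) in
/-- The cone of (unnormalised) separable operators. -/
def sepCone : AddSubmonoid (Matrix (a × b) (a × b) ℂ) :=
  AddSubmonoid.closure {M | ∃ (x : Matrix a a ℂ) (y : Matrix b b ℂ),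
    x.PosSemidef ∧ y.PosSemidef ∧ M = x ⊗ₖ y}

lemma kronecker_mem_sepCone {x : Matrix a a ℂ} {y : Matrix b b ℂ} (hx : x.PosSemidef)
    (hy : y.PosSemidef) : x ⊗ₖ y ∈ sepCone a b :=
  AddSubmonoid.subset_closure ⟨x, y, hx, hy, rfl⟩

lemma smul_mem_sepCone {M : Matrix (a × b) (a × b) ℂ} (hM : M ∈ sepCone a b) {t : ℝ} (ht : 0 ≤ t) :
    (t : ℂ) • M ∈ sepCone a b := by
  induction hM using AddSubmonoid.closure_induction with
  | mem M h =>
    obtain ⟨x, y, hx, hy, rfl⟩ := h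
    rw [← Matrix.smul_kronecker]
    exact kronecker_mem_sepCone (hx.smul (by exact_mod_cast ht)) hy
  | zero => rw [smul_zero]; exact zero_mem _
  | add _ _ _ _ h1 h2 => rw [smul_add]; exact add_mem h1 h2

lemma tensorMap_mem_sepCone {a' b' : Type} {S : SuperOp a a'}
    {T : SuperOp b b'} (hS : ∀ x, x.PosSemidef → (S x).PosSemidef)
    (hT : ∀ y, y.PosSemidef → (T y).PosSemidef) {M : Matrix (a × b) (a × b) ℂ}
    (h : M ∈ sepCone a b) : tensorMap S T M ∈ sepCone a' b' := by
  induction h using AddSubmonoid.closure_induction with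
  | mem M h =>
    obtain ⟨x, y, hx, hy, rfl⟩ := h
    rw [tensorMap_kronecker]
    exact kronecker_mem_sepCone (hS x hx) (hT y hy)
  | zero => rw [map_zero]; exact zero_mem _
  | add _ _ _ _ h1 h2 => rw [map_add]; exact add_mem h1 h2

end SepCone

/-! ### Compactness of the set of separable states -/

/-- By Carathéodory, `finrank + 1` points suffice, so the hull is the continuous image of a simplex
times a power of `s`. -/
lemma isCompact_convexHull_of_finiteDimensional {E : Type*} [AddCommGroup E] [Module ℝ E]
    [TopologicalSpace E] [ContinuousAdd E] [ContinuousSMul ℝ E] [FiniteDimensional ℝ E] {s : Set E}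
    (hs : IsCompact s) : IsCompact (convexHull ℝ s) := by
  let N := Module.finrank ℝ E + 1
  let f : (Fin N → ℝ) × (Fin N → E) → E := fun p => ∑ i, p.1 i • p.2 i
  have hf : Continuous f := by fun_prop
  have hK : IsCompact (f '' (stdSimplex ℝ (Fin N) ×ˢ Set.univ.pi fun _ => s)) :=
    ((isCompact_stdSimplex ℝ _).prod (isCompact_univ_pi fun _ => hs)).image hf
  convert hK
  ext x
  constructor
  · intro hx
    obtain ⟨ι, _, z, w, hz, hind, hw, hw1, hx⟩ := eq_pos_convex_span_of_mem_convexHull hx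
    have hcard : Fintype.card ι ≤ N :=
      hind.card_le_finrank_succ.trans (Nat.succ_le_succ (Submodule.finrank_le _))
    have : Nonempty ι := by
      by_contra h
      rw [not_nonempty_iff] at h
      simp at hw1
    obtain ⟨i₀⟩ := this
    obtain ⟨g⟩ : Nonempty (ι ↪ Fin N) := by
      rw [Function.Embedding.nonempty_iff_card_le]
      simpa using hcard
    -- Carathéodory may use fewer than `N` points; the unused slots get weight zero and an arbitrary
    -- point of `s`.
    refine ⟨(Function.extend g w 0, Function.extend g z fun _ => z i₀), ⟨⟨fun n => ?_, ?_⟩, ?_⟩, ?_⟩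
    · by_cases h : ∃ i, g i = n
      · obtain ⟨i, rfl⟩ := h
        simpa [g.injective.extend_apply] using (hw i).le
      · simp [Function.extend_apply' _ _ _ h]
    · rw [← hw1]
      refine (Fintype.sum_of_injective g g.injective _ _ (fun n hn => ?_) fun i => ?_).symm
      · exact Function.extend_apply' _ _ _ hn
      · exact (g.injective.extend_apply _ _ _).symm
    · intro n _
      by_cases h : ∃ i, g i = n
      · obtain ⟨i, rfl⟩ := h
        simpa [g.injective.extend_apply] using hz ⟨i, rfl⟩
      · simpa [Function.extend_apply' _ _ _ h] using hz ⟨i₀, rfl⟩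
    · rw [← hx]
      refine (Fintype.sum_of_injective g g.injective _ _ (fun n hn => ?_) fun i => ?_).symm
      · simp [Function.extend_apply' _ _ _ hn]
      · simp [g.injective.extend_apply]
  · rintro ⟨⟨w, z⟩, ⟨⟨hw, hw1⟩, hz⟩, rfl⟩
    exact mem_convexHull_of_exists_fintype w z hw hw1 (fun i => hz i trivial) rfl

/-! ### Separable states as a compact base of the separable cone -/

section SEP

variable {a b : Type} [Fintype a] [Fintype b]

open scoped MatrixOrder in
lemma exists_eq_conjTranspose_mul_self {ρ : Matrix a a ℂ} (h : ρ.PosSemidef) :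
    ∃ B : Matrix a a ℂ, ρ = Bᴴ * B := by
  classical
  obtain ⟨B, hB⟩ := CStarAlgebra.nonneg_iff_eq_star_mul_self.mp h.nonneg
  exact ⟨B, hB⟩

lemma trace_conjTranspose_mul_self_eq (B : Matrix a a ℂ) :
    (Bᴴ * B).trace = ((∑ j, ∑ i, ‖B i j‖ ^ 2 : ℝ) : ℂ) := by
  simp only [Matrix.trace, Matrix.diag_apply, Matrix.mul_apply, Matrix.conjTranspose_apply,
    Complex.ofReal_sum, Complex.star_def, Complex.conj_mul', Complex.ofReal_pow]

/-- Density operators are the image of the Frobenius unit sphere under `B ↦ B† B`. -/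
lemma isCompact_isDensity : IsCompact {ρ : Matrix a a ℂ | IsDensity ρ} := by
  have hK : IsCompact {B : Matrix a a ℂ | ∑ j, ∑ i, ‖B i j‖ ^ 2 = 1} := by
    refine IsCompact.of_isClosed_subset (isCompact_univ_pi fun _ => isCompact_univ_pi fun _ =>
      isCompact_closedBall (0 : ℂ) 1) ?_ ?_
    · refine isClosed_eq ?_ continuous_const
      refine continuous_finsetSum _ fun j _ => continuous_finsetSum _ fun i _ => ?_
      exact ((continuous_id.matrix_elem i j).norm).pow 2
    · intro B hB i _ j _
      have h1 : ‖B i j‖ ^ 2 ≤ ∑ i, ‖B i j‖ ^ 2 :=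
        Finset.single_le_sum (f := fun i => ‖B i j‖ ^ 2) (fun _ _ => by positivity)
          (Finset.mem_univ i)
      have h2 : ∑ i, ‖B i j‖ ^ 2 ≤ ∑ j, ∑ i, ‖B i j‖ ^ 2 :=
        Finset.single_le_sum (f := fun j => ∑ i, ‖B i j‖ ^ 2) (fun _ _ => by positivity)
          (Finset.mem_univ j)
      have h3 : ‖B i j‖ ^ 2 ≤ 1 := (h1.trans h2).trans_eq hB
      rw [mem_closedBall_zero_iff]
      exact (sq_le_one_iff₀ (norm_nonneg _)).1 h3
  have hf : Continuous fun B : Matrix a a ℂ => Bᴴ * B :=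
    continuous_id.matrix_conjTranspose.matrix_mul continuous_id
  convert hK.image hf
  ext ρ
  constructor
  · rintro ⟨h, ht⟩
    obtain ⟨B, rfl⟩ := exists_eq_conjTranspose_mul_self h
    rw [trace_conjTranspose_mul_self_eq] at ht
    exact ⟨B, by exact_mod_cast ht, rfl⟩
  · rintro ⟨B, hB, rfl⟩
    refine ⟨Matrix.posSemidef_conjTranspose_mul_self B, ?_⟩
    change (Bᴴ * B).trace = 1
    rw [trace_conjTranspose_mul_self_eq, hB, Complex.ofReal_one]

lemma SEP_eq_convexHull : SEP a b = convexHull ℝ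
    ((fun p : Matrix a a ℂ × Matrix b b ℂ => p.1 ⊗ₖ p.2) ''
      ({ρ | IsDensity ρ} ×ˢ {σ | IsDensity σ})) := by
  ext ω
  constructor
  · rintro ⟨m, p, ρ, σ, hp, hp1, hρ, hσ, rfl⟩
    refine mem_convexHull_of_exists_fintype p (fun i => ρ i ⊗ₖ σ i) hp hp1
      (fun i => ⟨(ρ i, σ i), ⟨hρ i, hσ i⟩, rfl⟩) ?_
    exact Finset.sum_congr rfl fun i _ => (Complex.coe_smul _ _).symm
  · intro h
    obtain ⟨ι, _, w, z, hw, hw1, hz, rfl⟩ := mem_convexHull_iff_exists_fintype.1 h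
    choose p hp hpz using hz
    let e := Fintype.equivFin ι
    refine ⟨Fintype.card ι, w ∘ e.symm, fun i => (p (e.symm i)).1, fun i => (p (e.symm i)).2,
      fun i => hw _, ?_, fun i => (hp _).1, fun i => (hp _).2, ?_⟩
    · rw [← hw1]
      exact Equiv.sum_comp e.symm w
    · rw [← Equiv.sum_comp e.symm]
      refine Finset.sum_congr rfl fun i _ => ?_
      rw [← hpz]
      exact (Complex.coe_smul _ _).symm

lemma kronecker_mem_SEP {ρ : Matrix a a ℂ} {σ : Matrix b b ℂ} (hρ : IsDensity ρ)
    (hσ : IsDensity σ) : ρ ⊗ₖ σ ∈ SEP a b := by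
  rw [SEP_eq_convexHull]
  exact subset_convexHull _ _ ⟨(ρ, σ), ⟨hρ, hσ⟩, rfl⟩

lemma isCompact_SEP : IsCompact (SEP a b) := by
  rw [SEP_eq_convexHull]
  refine isCompact_convexHull_of_finiteDimensional
    ((isCompact_isDensity.prod isCompact_isDensity).image ?_)
  refine continuous_matrix fun i j => ?_
  exact (continuous_fst.matrix_elem _ _).mul (continuous_snd.matrix_elem _ _)

lemma convex_SEP : Convex ℝ (SEP a b) := by
  rw [SEP_eq_convexHull]
  exact convex_convexHull _ _

lemma trace_of_mem_SEP {ω : Matrix (a × b) (a × b) ℂ} (h : ω ∈ SEP a b) : ω.trace = 1 := by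
  obtain ⟨m, p, ρ, σ, hp, hp1, hρ, hσ, rfl⟩ := h
  simp only [Matrix.trace_sum, Matrix.trace_smul, Matrix.trace_kronecker, (hρ _).2, (hσ _).2,
    mul_one, smul_eq_mul]
  exact_mod_cast hp1

lemma isDensity_single [DecidableEq a] (i : a) : IsDensity (Matrix.single i i (1 : ℂ)) := by
  refine ⟨?_, Matrix.trace_single_eq_same _ _⟩
  have h := Matrix.posSemidef_vecMulVec_self_star (Pi.single i (1 : ℂ))
  convert h using 1
  rw [Matrix.single_eq_single_vecMulVec_single]
  simp

lemma SEP_nonempty [Nonempty a] [Nonempty b] : (SEP a b).Nonempty := by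
  classical
  exact ⟨_, kronecker_mem_SEP (isDensity_single (Classical.arbitrary a))
    (isDensity_single (Classical.arbitrary b))⟩

lemma mem_sepCone_of_mem_SEP {ω : Matrix (a × b) (a × b) ℂ} (h : ω ∈ SEP a b) :
    ω ∈ sepCone a b := by
  obtain ⟨m, p, ρ, σ, hp, hp1, hρ, hσ, rfl⟩ := h
  exact sum_mem fun i _ => smul_mem_sepCone (kronecker_mem_sepCone (hρ i).1 (hσ i).1) (hp i)

lemma exists_eq_smul_isDensity [Nonempty a] {x : Matrix a a ℂ} (hx : x.PosSemidef) :
    ∃ t : ℝ, 0 ≤ t ∧ ∃ ρ, IsDensity ρ ∧ x = (t : ℂ) • ρ := by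
  classical
  have htr := hx.trace_nonneg
  obtain ⟨t, ht⟩ : ∃ t : ℝ, x.trace = (t : ℂ) := ⟨x.trace.re, by
    rw [Complex.nonneg_iff] at htr
    exact Complex.ext rfl htr.2.symm⟩
  rw [ht] at htr
  have ht0 : 0 ≤ t := by exact_mod_cast htr
  refine ⟨t, ht0, ?_⟩
  by_cases h : t = 0
  · refine ⟨_, isDensity_single (Classical.arbitrary a), ?_⟩
    rw [h, Complex.ofReal_zero, zero_smul]
    refine hx.trace_eq_zero_iff.1 ?_
    rw [ht, h, Complex.ofReal_zero]
  · have hc : (t : ℂ) ≠ 0 := by exact_mod_cast h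
    refine ⟨((t⁻¹ : ℝ) : ℂ) • x, ⟨hx.smul ?_, ?_⟩, ?_⟩
    · exact_mod_cast inv_nonneg.2 ht0
    · rw [Matrix.trace_smul, ht, smul_eq_mul, Complex.ofReal_inv, inv_mul_cancel₀ hc]
    · rw [Complex.ofReal_inv, smul_smul, mul_inv_cancel₀ hc, one_smul]

lemma mem_sepCone_iff [Nonempty a] [Nonempty b] {M : Matrix (a × b) (a × b) ℂ} :
    M ∈ sepCone a b ↔ ∃ t : ℝ, 0 ≤ t ∧ ∃ ω ∈ SEP a b, M = (t : ℂ) • ω := by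
  constructor
  · intro hM
    induction hM using AddSubmonoid.closure_induction with
    | mem M h =>
      obtain ⟨x, y, hx, hy, rfl⟩ := h
      obtain ⟨s, hs, ρ, hρ, rfl⟩ := exists_eq_smul_isDensity hx
      obtain ⟨t, ht, σ, hσ, rfl⟩ := exists_eq_smul_isDensity hy
      refine ⟨s * t, mul_nonneg hs ht, _, kronecker_mem_SEP hρ hσ, ?_⟩
      rw [Matrix.smul_kronecker, Matrix.kronecker_smul, smul_smul, Complex.ofReal_mul]
    | zero =>
      obtain ⟨ω, hω⟩ := SEP_nonempty (a := a) (b := b)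
      exact ⟨0, le_rfl, ω, hω, by simp⟩
    | add _ _ _ _ h1 h2 =>
      obtain ⟨s, hs, ρ, hρ, rfl⟩ := h1
      obtain ⟨t, ht, σ, hσ, rfl⟩ := h2
      by_cases h : s + t = 0
      · obtain rfl : s = 0 := by linarith
        obtain rfl : t = 0 := by linarith
        exact ⟨0, le_rfl, ρ, hρ, by simp⟩
      · have h' : (s : ℂ) + t ≠ 0 := by exact_mod_cast h
        refine ⟨s + t, add_nonneg hs ht, _, convex_SEP hρ hσ
          (show 0 ≤ s / (s + t) by positivity) (show 0 ≤ t / (s + t) by positivity)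
          (by rw [← add_div, div_self h]), ?_⟩
        rw [← Complex.coe_smul, ← Complex.coe_smul, smul_add, smul_smul, smul_smul]
        push_cast
        rw [mul_div_cancel₀ _ h', mul_div_cancel₀ _ h']
  · rintro ⟨t, ht, ω, hω, rfl⟩
    exact smul_mem_sepCone (mem_sepCone_of_mem_SEP hω) ht

/-- The trace recovers the scale of an element `t • ω`. Along a convergent sequence the scales
therefore converge, and compactness of `SEP` gives a convergent subsequence of the states. -/
lemma isClosed_sepCone : IsClosed (sepCone a b : Set (Matrix (a × b) (a × b) ℂ)) := by
  by_cases hn : Nonempty a ∧ Nonempty b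
  swap
  · have : IsEmpty (a × b) := by
      rw [isEmpty_prod]
      rw [not_and_or, not_nonempty_iff, not_nonempty_iff] at hn
      exact hn
    exact (Set.toFinite _).isClosed
  obtain ⟨_, _⟩ := hn
  have hK := isCompact_SEP (a := a) (b := b)
  have hset : (sepCone a b : Set (Matrix (a × b) (a × b) ℂ)) =
      {M | ∃ t : ℝ, 0 ≤ t ∧ ∃ ω ∈ SEP a b, M = (t : ℂ) • ω} :=
    Set.ext fun M => mem_sepCone_iff
  rw [hset]
  have : FirstCountableTopology (Matrix (a × b) (a × b) ℂ) :=
    inferInstanceAs (FirstCountableTopology (a × b → a × b → ℂ))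
  refine IsSeqClosed.isClosed ?_
  intro u M hu hM
  choose t ht ω hω huω using hu
  obtain ⟨ω₀, hω₀, φ, hφ, hlim⟩ := hK.tendsto_subseq hω
  have htr : ∀ n, t n = (u n).trace.re := fun n => by
    rw [huω, Matrix.trace_smul, trace_of_mem_SEP (hω n)]
    simp
  have htl : Filter.Tendsto t Filter.atTop (𝓝 M.trace.re) := by
    simp only [funext htr]
    exact ((Complex.continuous_re.comp continuous_id.matrix_trace).tendsto M).comp hM
  refine ⟨M.trace.re, ge_of_tendsto' htl ht, ω₀, hω₀, ?_⟩
  refine tendsto_nhds_unique (hM.comp hφ.tendsto_atTop) ?_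
  have h1 := ((Complex.continuous_ofReal.tendsto _).comp (htl.comp hφ.tendsto_atTop)).smul hlim
  refine h1.congr fun n => ?_
  simp [huω]

lemma hasSum_mem_sepCone {Θ : Type} {f : Θ → Matrix (a × b) (a × b) ℂ}
    {M : Matrix (a × b) (a × b) ℂ} (h : HasSum f M) (hf : ∀ θ, f θ ∈ sepCone a b) :
    M ∈ sepCone a b :=
  isClosed_sepCone.mem_of_tendsto h (Filter.Eventually.of_forall fun _ => sum_mem fun i _ => hf i)

lemma trace_re_nonneg_of_mem_sepCone {M : Matrix (a × b) (a × b) ℂ} (h : M ∈ sepCone a b) :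
    0 ≤ M.trace.re := by
  induction h using AddSubmonoid.closure_induction with
  | mem M h =>
    obtain ⟨x, y, hx, hy, rfl⟩ := h
    exact (Complex.nonneg_iff.1 (hx.kronecker hy).trace_nonneg).1
  | zero => simp
  | add _ _ _ _ h1 h2 => simpa using add_nonneg h1 h2

lemma exists_eq_trace_smul [Nonempty a] [Nonempty b] {M : Matrix (a × b) (a × b) ℂ}
    (h : M ∈ sepCone a b) : ∃ ω ∈ SEP a b, M = (M.trace.re : ℂ) • ω := by
  obtain ⟨t, ht, ω, hω, rfl⟩ := mem_sepCone_iff.1 h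
  refine ⟨ω, hω, ?_⟩
  rw [Matrix.trace_smul, trace_of_mem_SEP hω]
  simp

end SEP

/-! ### LOCC instruments are separable -/

section Separable

variable {a b a' b' a'' b'' : Type} [Fintype a] [DecidableEq a] [Fintype b] [DecidableEq b]
  [Fintype a'] [Fintype b'] [Fintype a''] [Fintype b'']

/-- Separable superoperators, i.e. those whose Choi operator is separable. -/
def IsSeparableMap (Φ : SuperOp (a × b) (a' × b')) : Prop :=
  bipartiteChoi Φ ∈ sepCone (a × a') (b × b')

lemma isSeparableMap_id : IsSeparableMap (LinearMap.id : SuperOp (a × b) (a × b)) := by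
  rw [IsSeparableMap, ← tensorMap_id_id, bipartiteChoi_tensorMap]
  exact kronecker_mem_sepCone isCP_id.posSemidef_choi isCP_id.posSemidef_choi

lemma IsSeparableMap.tensorMap_comp {Φ : SuperOp (a × b) (a' × b')} (hΦ : IsSeparableMap Φ)
    {S : SuperOp a' a''} {T : SuperOp b' b''} (hS : IsCP S) (hT : IsCP T) :
    IsSeparableMap ((tensorMap S T).comp Φ) := by
  rw [IsSeparableMap, bipartiteChoi_comp]
  exact tensorMap_mem_sepCone (fun x hx => hS.posSemidef_id_tensorMap hx)
    (fun y hy => hT.posSemidef_id_tensorMap hy) hΦ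

lemma IsSeparableMap.of_isSum {Θ : Type} {E : Θ → SuperOp (a × b) (a' × b')}
    {Φ : SuperOp (a × b) (a' × b')} (hE : ∀ θ, IsSeparableMap (E θ)) (h : IsSum E Φ) :
    IsSeparableMap Φ :=
  hasSum_mem_sepCone (hasSum_bipartiteChoi h) hE

lemma IsSeparableMap.of_isCoarseGraining {Θ Λ : Type} {E : Θ → SuperOp (a × b) (a' × b')}
    {F : Λ → SuperOp (a × b) (a' × b')} (hE : ∀ θ, IsSeparableMap (E θ))
    (h : IsCoarseGraining E F) (l : Λ) : IsSeparableMap (F l) := by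
  obtain ⟨f, hf⟩ := h
  exact .of_isSum (E := fun θ : {θ // f θ = l} => E θ) (fun θ => hE θ) (hf l)

lemma IsSeparableMap.of_locclinked {Θ Λ : Type} {I : Θ → SuperOp (a × b) (a' × b')}
    {J : Λ → SuperOp (a × b) (a'' × b'')} (hI : ∀ θ, IsSeparableMap (I θ)) (h : LOCCLinked I J)
    (l : Λ) : IsSeparableMap (J l) := by
  obtain ⟨Ξ, F, hF, hJ⟩ := h
  refine .of_isCoarseGraining (fun p => ?_) hJ l
  rcases hF p.1 with ⟨E, T, hE, hT, hFE⟩ | ⟨T, E, hT, hE, hFE⟩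
  · simp only [hFE]
    exact (hI _).tensorMap_comp (hE.2.1 _) (hT _).1
  · simp only [hFE]
    exact (hI _).tensorMap_comp (hT _).1 (hE.2.1 _)

/-- Induction over rounds handles every finite stage; closedness of the cone handles both the
countable merging of outcomes and the limit of infinitely many rounds. -/
lemma isSeparableMap_of_mem_LOCCInstr {Θ : Type} {E : Θ → SuperOp (a × b) (a' × b')}
    (h : E ∈ LOCCInstr a b a' b' Θ) (θ : Θ) : IsSeparableMap (E θ) := by
  obtain ⟨-, A, B, Ξ, I, D, J, h0, hI, hD, hJ, hlim⟩ := h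
  have hsep : ∀ r ξ, IsSeparableMap (I r ξ) := by
    intro r
    induction r with
    | zero => exact .of_locclinked (fun _ => isSeparableMap_id) h0
    | succ r ih => exact .of_locclinked ih (hI r)
  have hJs : ∀ r θ, IsSeparableMap (J r θ) := by
    intro r
    refine .of_isCoarseGraining (fun ξ => ?_) (hJ r)
    obtain ⟨S, T, hS, hT, hST⟩ := hD r ξ
    rw [hST]
    exact (hsep r ξ).tensorMap_comp hS.1 hT.1
  exact isClosed_sepCone.mem_of_tendsto (tendsto_bipartiteChoi (hlim θ))
    (Filter.Eventually.of_forall fun r => hJs r θ)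

/-- `P` and `N` collect the positive and negative parts of `β`. Their total trace is at most that of
the Choi operator of the whole instrument, because `|β| ≤ 1`, and this is one by trace preservation.
-/
lemma exists_sub_of_mem_LOCCStar [Nonempty a] [Nonempty b] {F : SuperOp (a × b) (a × b)}
    (h : F ∈ LOCCStar a b) : ∃ P ∈ sepCone (a × a) (b × b), ∃ N ∈ sepCone (a × a) (b × b),
      bipartiteChoi F = P - N ∧ P.trace.re + N.trace.re ≤ 1 := by
  obtain ⟨Θ, E, β, hE, hβ, hF⟩ := h
  have hsep := isSeparableMap_of_mem_LOCCInstr hE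
  obtain ⟨⟨-, -, Φ, hΦ, hsum⟩, -⟩ := hE
  have hc := hasSum_bipartiteChoi hsum
  -- Entrywise, unconditional convergence is absolute, so bounded coefficients do not destroy
  -- summability.
  have key : ∀ r : Θ → ℝ, (∀ θ, |r θ| ≤ 1) →
      Summable fun θ => (r θ : ℂ) • bipartiteChoi (E θ) := by
    intro r hr
    refine Pi.summable.2 fun p => Pi.summable.2 fun q => ?_
    refine Summable.of_norm_bounded ((Pi.summable.1 (Pi.summable.1 hc.summable p) q).norm) ?_
    intro θ
    simp only [Matrix.smul_apply, smul_eq_mul, norm_mul, Complex.norm_real, Real.norm_eq_abs]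
    exact mul_le_of_le_one_left (norm_nonneg _) (hr θ)
  have hP := (key (fun θ => max (β θ) 0) (fun θ => by
    have := hβ θ
    rw [abs_of_nonneg (le_max_right _ _)]
    exact max_le this.2 zero_le_one)).hasSum
  have hN := (key (fun θ => max (-β θ) 0) (fun θ => by
    have := hβ θ
    rw [abs_of_nonneg (le_max_right _ _)]
    exact max_le (by linarith [this.1]) zero_le_one)).hasSum
  set P := ∑' θ, ((max (β θ) 0 : ℝ) : ℂ) • bipartiteChoi (E θ)
  set N := ∑' θ, ((max (-β θ) 0 : ℝ) : ℂ) • bipartiteChoi (E θ)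
  refine ⟨P, hasSum_mem_sepCone hP fun θ => smul_mem_sepCone (hsep θ) (le_max_right _ _),
    N, hasSum_mem_sepCone hN fun θ => smul_mem_sepCone (hsep θ) (le_max_right _ _), ?_, ?_⟩
  · refine (hasSum_bipartiteChoi hF).unique ?_
    have h1 := hP.sub hN
    refine (funext fun θ => ?_ : (fun θ => bipartiteChoi ((β θ : ℂ) • E θ)) = _) ▸ h1
    rw [bipartiteChoi_smul, ← sub_smul, ← Complex.ofReal_sub]
    congr 2
    exact (posPart_sub_negPart (β θ)).symm
  · let tr : Matrix ((a × a) × (b × b)) ((a × a) × (b × b)) ℂ →+ ℝ :=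
      Complex.reAddGroupHom.comp (Matrix.traceAddMonoidHom _ _)
    have htr : Continuous tr := Complex.continuous_re.comp continuous_id.matrix_trace
    have h1 := (hP.add hN).map tr htr
    have h2 := hc.map tr htr
    have h3 := hasSum_le (fun θ => ?_) h1 h2
    · have h4 : tr (bipartiteChoi Φ) = 1 := by
        change (bipartiteChoi Φ).trace.re = 1
        rw [trace_bipartiteChoi_of_isTP hΦ, Complex.one_re]
      rw [h4, map_add] at h3
      exact h3
    · have h5 := trace_re_nonneg_of_mem_sepCone (hsep θ)
      change (((max (β θ) 0 : ℝ) : ℂ) • bipartiteChoi (E θ)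
        + ((max (-β θ) 0 : ℝ) : ℂ) • bipartiteChoi (E θ)).trace.re ≤ (bipartiteChoi (E θ)).trace.re
      rw [← add_smul, ← Complex.ofReal_add, Matrix.trace_smul, smul_eq_mul, Complex.re_ofReal_mul]
      refine mul_le_of_le_one_left h5 ?_
      have := hβ θ
      rcases le_total 0 (β θ) with h | h
      · rw [max_eq_left h, max_eq_right (by linarith)]
        linarith [this.2]
      · rw [max_eq_right h, max_eq_left (by linarith)]
        linarith [this.1]

/-- Each term `c • F` becomes two separable terms whose weights add up to at most `|c|`, one from
`P` and one, with the opposite sign, from `N`. -/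
theorem gamma_SEP_le_gamma_LOCCStar [Nonempty a] [Nonempty b] (Φ : SuperOp (a × b) (a × b)) :
    gamma (SEP (a × a) (b × b)) (bipartiteChoi Φ) ≤ gamma (LOCCStar a b) Φ := by
  refine gamma_le_gamma fun m c F hm hF hΦ => ?_
  have : Nonempty (Fin m) := ⟨⟨0, hm⟩⟩
  choose P hP N hN hPN htr using fun i => exists_sub_of_mem_LOCCStar (hF i)
  choose ω hω hPω using fun i => exists_eq_trace_smul (hP i)
  choose τ hτ hNτ using fun i => exists_eq_trace_smul (hN i)
  refine gamma_le_of_sum (ι := Fin m ⊕ Fin m)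
    (Sum.elim (fun i => c i * (P i).trace.re) fun i => -(c i * (N i).trace.re)) (Sum.elim ω τ)
    (by rintro (i | i); exacts [hω i, hτ i]) ?_ ?_
  · rw [hΦ, bipartiteChoi_sum_smul, Fintype.sum_sum_type, ← Finset.sum_add_distrib]
    refine Finset.sum_congr rfl fun i _ => ?_
    rw [hPN, smul_sub, sub_eq_add_neg]
    simp only [Sum.elim_inl, Sum.elim_inr, Complex.ofReal_neg, Complex.ofReal_mul, neg_smul,
      mul_smul]
    rw [← hPω, ← hNτ]
  · rw [Fintype.sum_sum_type, ← Finset.sum_add_distrib]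
    refine Finset.sum_le_sum fun i _ => ?_
    simp only [Sum.elim_inl, Sum.elim_inr, abs_neg, abs_mul,
      abs_of_nonneg (trace_re_nonneg_of_mem_sepCone (hP i)),
      abs_of_nonneg (trace_re_nonneg_of_mem_sepCone (hN i))]
    rw [← mul_add]
    exact mul_le_of_le_one_right (abs_nonneg _) (htr i)

end Separable

/-! ### Pauli strings -/

section Pauli

lemma conjTranspose_mul_pauli (q : Fin 4) : (pauli q)ᴴ * pauli q = 1 := by
  fin_cases q <;> ext i j <;> fin_cases i <;> fin_cases j <;> simp [pauli, Matrix.mul_apply]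

lemma sum_pauli_mul_star_pauli (i j k l : Fin 2) :
    ∑ q, pauli q i j * star (pauli q k l) = if i = k ∧ j = l then 2 else 0 := by
  fin_cases i <;> fin_cases j <;> fin_cases k <;> fin_cases l <;>
    simp [pauli, Fin.sum_univ_four] <;> norm_num

variable {ι : Type} [Fintype ι] [DecidableEq ι]

lemma conjTranspose_mul_pauliString (Q : ι → Fin 4) :
    (pauliString Q)ᴴ * pauliString Q = 1 := by
  ext x y
  have h := fun k => congrFun (congrFun (conjTranspose_mul_pauli (Q k)) (x k)) (y k)
  simp only [Matrix.mul_apply, Matrix.conjTranspose_apply, Matrix.one_apply] at h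
  simp only [Matrix.mul_apply, Matrix.conjTranspose_apply, pauliString, Matrix.of_apply,
    star_prod, ← Finset.prod_mul_distrib]
  rw [← Fintype.piFinset_univ, ← Finset.prod_univ_sum (fun _ => Finset.univ)
    (fun k z => star (pauli (Q k) z (x k)) * pauli (Q k) z (y k))]
  simp only [h, Matrix.one_apply, Finset.prod_ite_zero, Finset.prod_const_one, Finset.mem_univ,
    forall_const, funext_iff]

lemma pauliString_mul_conjTranspose (Q : ι → Fin 4) :
    pauliString Q * (pauliString Q)ᴴ = 1 :=
  mul_eq_one_comm.1 (conjTranspose_mul_pauliString Q)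

/-- The completeness relation of the Pauli basis, which factors over the qubits after exchanging sum
and product. -/
lemma sum_pauliString_mul_star_pauliString (x y x' y' : Bits ι) :
    ∑ Q, pauliString Q x y * star (pauliString Q x' y') =
      if x = x' ∧ y = y' then (Fintype.card (Bits ι) : ℂ) else 0 := by
  simp only [pauliString, Matrix.of_apply, star_prod, ← Finset.prod_mul_distrib]
  rw [← Fintype.piFinset_univ, ← Finset.prod_univ_sum (fun _ => Finset.univ)
    (fun k q => pauli q (x k) (y k) * star (pauli q (x' k) (y' k)))]
  simp only [sum_pauli_mul_star_pauli, Finset.prod_ite_zero, Finset.mem_univ, forall_const,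
    funext_iff, Finset.prod_const, ← forall_and]
  simp

/-- The Pauli twirl erases everything but the trace; this is what makes the teleportation instrument
trace-preserving. -/
lemma sum_pauliString_conj (X : Matrix (Bits ι) (Bits ι) ℂ) :
    ∑ Q, pauliString Q * X * (pauliString Q)ᴴ
      = ((Fintype.card (Bits ι) : ℂ) * X.trace) • (1 : Matrix (Bits ι) (Bits ι) ℂ) := by
  ext x x'
  have h : ∀ Q, (pauliString Q * X * (pauliString Q)ᴴ) x x'
      = ∑ y', ∑ y, X y y' * (pauliString Q x y * star (pauliString Q x' y')) := by
    intro Q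
    simp only [Matrix.mul_apply, Finset.sum_mul, Matrix.conjTranspose_apply]
    exact Finset.sum_congr rfl fun _ _ => Finset.sum_congr rfl fun _ _ => by ring
  simp only [Matrix.sum_apply, h]
  rw [Finset.sum_comm]
  have h2 : ∀ y', ∑ Q : ι → Fin 4, ∑ y, X y y' * (pauliString Q x y * star (pauliString Q x' y'))
      = if x = x' then (Fintype.card (Bits ι) : ℂ) * X y' y' else 0 := by
    intro y'
    rw [Finset.sum_comm]
    simp only [← Finset.mul_sum, sum_pauliString_mul_star_pauliString]
    by_cases hx : x = x' <;> simp [hx, mul_comm]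
  simp only [h2, Matrix.smul_apply, Matrix.one_apply, Matrix.trace, Matrix.diag_apply]
  by_cases hx : x = x' <;> simp [hx, Finset.mul_sum]

end Pauli

/-! ### Two-round protocols -/

section Protocol

variable {a b c a' b' : Type}

lemma isSum_fintype {Θ : Type} [Fintype Θ] (E : Θ → SuperOp a b) : IsSum E (∑ θ, E θ) := by
  intro X
  rw [LinearMap.sum_apply]
  exact hasSum_fintype _

lemma isCoarseGraining_of_equiv {Θ Λ : Type} {E : Θ → SuperOp a b} {F : Λ → SuperOp a b}
    (e : Θ ≃ Λ) (h : ∀ θ, F (e θ) = E θ) : IsCoarseGraining E F := by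
  refine ⟨e, fun l X => ?_⟩
  have h1 := hasSum_single (f := fun θ : {θ // e θ = l} => E θ X) ⟨e.symm l, by simp⟩ (by
    rintro ⟨θ, rfl⟩ hθ
    simp at hθ)
  simpa [← h] using h1

lemma isCoarseGraining_sum {Θ : Type} [Fintype Θ] (E : Θ → SuperOp a b) :
    IsCoarseGraining E fun _ : Unit => ∑ θ, E θ := by
  refine ⟨fun _ => (), fun l X => ?_⟩
  exact (Equiv.subtypeUnivEquiv fun _ => rfl).hasSum_iff.2 (isSum_fintype E X)

variable [Fintype a] [Fintype b] [Fintype c] [Fintype a'] [Fintype b']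

lemma isInstrument_of_fintype {Θ : Type} [Fintype Θ] {E : Θ → SuperOp a b}
    (hE : ∀ θ, IsCP (E θ)) (h : ∀ X, ∑ θ, (E θ X).trace = X.trace) : IsInstrument E := by
  refine ⟨inferInstance, hE, _, fun X => ?_, isSum_fintype E⟩
  rw [LinearMap.sum_apply, Matrix.trace_sum]
  exact h X

lemma IsInstrument.sum_trace {Θ : Type} [Fintype Θ] {E : Θ → SuperOp a b} (hE : IsInstrument E)
    (X : Matrix a a ℂ) : ∑ θ, (E θ X).trace = X.trace := by
  obtain ⟨-, -, Φ, hΦ, hs⟩ := hE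
  have := (hs X).unique (hasSum_fintype _)
  rw [← hΦ X, this, Matrix.trace_sum]

lemma IsChannel.isInstrument {E : SuperOp a b} (hE : IsChannel E) :
    IsInstrument fun _ : Unit => E :=
  isInstrument_of_fintype (fun _ => hE.1) fun X => by simpa using hE.2 X

lemma IsCP.sum {Θ : Type} [Fintype Θ] {E : Θ → SuperOp a b} (hE : ∀ θ, IsCP (E θ)) :
    IsCP (∑ θ, E θ) := by
  intro k X hX
  have : tensorMap (∑ θ, E θ) (LinearMap.id : SuperOp (Fin k) (Fin k)) X
      = ∑ θ, tensorMap (E θ) (LinearMap.id : SuperOp (Fin k) (Fin k)) X := by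
    ext p q
    simp [tensorMap_apply, LinearMap.sum_apply, Matrix.sum_apply]
  rw [this]
  exact Matrix.posSemidef_sum _ fun θ _ => hE θ k X hX

lemma IsCP.posSemidef_tensorMap_id {Φ : SuperOp a b} (hΦ : IsCP Φ)
    {X : Matrix (a × c) (a × c) ℂ} (hX : X.PosSemidef) :
    (tensorMap Φ (LinearMap.id : SuperOp c c) X).PosSemidef :=
  (hΦ.posSemidef_id_tensorMap (hX.submatrix Prod.swap)).submatrix Prod.swap

lemma IsCP.tensorMap {S : SuperOp a a'} {T : SuperOp b b'} (hS : IsCP S) (hT : IsCP T) :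
    IsCP (tensorMap S T) := by
  intro k X hX
  have h1 := hS.posSemidef_tensorMap_id
    (hX.submatrix fun p : a × (b × Fin k) => ((p.1, p.2.1), p.2.2))
  have h2 := hT.posSemidef_tensorMap_id
    (h1.submatrix fun p : b × (a' × Fin k) => (p.2.1, (p.1, p.2.2)))
  exact h2.submatrix fun p : (a' × b') × Fin k => (p.1.2, (p.1.1, p.2))

lemma isOneWayLocal_id : IsOneWayLocal
    fun _ : Unit => (LinearMap.id : SuperOp (a × b) (a × b)) := by
  refine Or.inl ⟨fun _ => LinearMap.id, fun _ => LinearMap.id, isChannel_id.isInstrument,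
    fun _ => isChannel_id, fun _ => ?_⟩
  exact tensorMap_id_id.symm

lemma locclinked_self {s Θ : Type} [Fintype s] (I : Θ → SuperOp s (a × b)) : LOCCLinked I I :=
  ⟨fun _ => Unit, fun _ _ => LinearMap.id, fun _ => isOneWayLocal_id,
    isCoarseGraining_of_equiv ((Equiv.sigmaEquivProd _ _).trans (Equiv.prodPUnit _)) fun _ => rfl⟩

/-- The outcomes of a two-round protocol after each round. -/
def twoRoundOutcome (P Q : Type) : ℕ → Type
  | 0 => P
  | _ + 1 => P × Q

/-- The instruments of a two-round protocol which idles after the second round. -/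
def twoRound {s t P Q : Type} (E : P → SuperOp s t) (F : P × Q → SuperOp s t) :
    ∀ r, twoRoundOutcome P Q r → SuperOp s t
  | 0 => E
  | _ + 1 => F

/-- One party applies the instrument `E`, and then the other one applies an instrument `G p`
depending on the outcome `p` of `E`, and the first party corrects. -/
lemma sum_mem_LOCC {P Q : Type} [Fintype P] [Fintype Q] {E : P → SuperOp a a}
    {T : P → Q → SuperOp a a} {G : P → Q → SuperOp b b} (hE : IsInstrument E)
    (hT : ∀ p q, IsChannel (T p q)) (hG : ∀ p, IsInstrument (G p)) :
    ∑ p : P × Q, tensorMap ((T p.1 p.2).comp (E p.1)) (G p.1 p.2) ∈ LOCC a b := by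
  classical
  let I₀ : P → SuperOp (a × b) (a × b) := fun p => tensorMap (E p) LinearMap.id
  let I₁ : P × Q → SuperOp (a × b) (a × b) :=
    fun p => tensorMap ((T p.1 p.2).comp (E p.1)) (G p.1 p.2)
  let Φ := ∑ p, I₁ p
  have hCP : IsCP Φ := IsCP.sum fun p => ((hT _ _).1.comp (hE.2.1 _)).tensorMap ((hG _).2.1 _)
  have hTP : IsTP Φ := by
    intro X
    -- On product inputs the sum over the second party's outcomes is done first: its instrument
    -- depends on `p`, but its total trace does not.
    have h : (Matrix.traceLinearMap (a × b) ℂ ℂ).comp Φ = Matrix.traceLinearMap (a × b) ℂ ℂ := by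
      refine linearMap_ext_kronecker fun x y => ?_
      simp only [Φ, I₁, LinearMap.comp_apply, LinearMap.sum_apply, tensorMap_kronecker,
        Matrix.traceLinearMap_apply, Matrix.trace_sum, Matrix.trace_kronecker,
        (hT _ _).2 _, Fintype.sum_prod_type, ← Finset.mul_sum, (hG _).sum_trace,
        ← Finset.sum_mul, hE.sum_trace]
    exact LinearMap.congr_fun h X
  have h₀ : LOCCLinked (fun _ : Unit => (LinearMap.id : SuperOp (a × b) (a × b))) I₀ := by
    refine ⟨fun _ => P, fun _ => I₀, fun _ => Or.inl ⟨E, fun _ => LinearMap.id, hE,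
      fun _ => isChannel_id, fun _ => rfl⟩, ?_⟩
    exact isCoarseGraining_of_equiv ((Equiv.sigmaEquivProd _ _).trans (Equiv.punitProd _))
      fun _ => rfl
  have h₁ : LOCCLinked I₀ I₁ := by
    refine ⟨fun _ => Q, fun p q => tensorMap (T p q) (G p q), fun p => Or.inr ⟨T p, G p, hT p,
      hG p, fun _ => rfl⟩, ?_⟩
    refine isCoarseGraining_of_equiv (Equiv.sigmaEquivProd _ _) fun p => ?_
    exact (tensorMap_comp (E p.1) LinearMap.id (T p.1 p.2) (G p.1 p.2)).symm
  -- Stopping after round `0` gives some other channel; from round `1` on the stopped channel is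
  -- exactly `Φ`, so the limit is trivial.
  have hJ : ∀ r, ∃ J : Unit → SuperOp (a × b) (a × b),
      IsCoarseGraining (fun ξ => LinearMap.id.comp (twoRound I₀ I₁ r ξ)) J ∧
        (1 ≤ r → J = fun _ => Φ) := by
    rintro (_ | r)
    · exact ⟨_, isCoarseGraining_sum I₀, by simp⟩
    · exact ⟨_, isCoarseGraining_sum I₁, fun _ => rfl⟩
  choose J hJ hJΦ using hJ
  refine ⟨Unit, fun _ => Φ, ⟨IsChannel.isInstrument ⟨hCP, hTP⟩, fun _ => ⟨a⟩, fun _ => ⟨b⟩,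
    twoRoundOutcome P Q, twoRound I₀ I₁, fun _ _ => LinearMap.id, J, h₀, ?_, fun _ _ =>
    ⟨LinearMap.id, LinearMap.id, isChannel_id, isChannel_id, tensorMap_id_id.symm⟩, hJ, ?_⟩, ?_⟩
  · rintro (_ | r)
    · exact h₁
    · exact locclinked_self I₁
  · intro θ X
    refine tendsto_const_nhds.congr' ?_
    filter_upwards [Filter.eventually_ge_atTop 1] with r hr
    rw [hJΦ r hr]
  · simpa using isSum_fintype fun _ : Unit => Φ

end Protocol

/-! ### Gate teleportation -/

section Teleportation

/-- One party's part of gate teleportation with resource `ρ`: up to the probability factor, outcome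
`Q` of the Bell measurement applies the map of `ρ` to the input conjugated by `Q`, followed by a
correction. Traces add up because the twirl yields a multiple of the identity, on which `ofChoi ρ`
has trace `tr ρ = 1`. -/
lemma isInstrument_teleport {ι c : Type} [Fintype ι] [DecidableEq ι] [Fintype c]
    {ρ : Matrix (Bits ι × c) (Bits ι × c) ℂ} (hρ : IsDensity ρ)
    {T : (ι → Fin 4) → SuperOp c c} (hT : ∀ Q, IsChannel (T Q)) :
    IsInstrument fun Q : ι → Fin 4 => (T Q).comp ((((Fintype.card (Bits ι) : ℝ)⁻¹ : ℝ) : ℂ) •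
      (ofChoi ρ).comp (inducedMap (pauliString Q))) := by
  refine isInstrument_of_fintype (fun Q => (hT Q).1.comp ?_) fun X => ?_
  · exact ((isCP_ofChoi hρ.1).comp (isCP_inducedMap _)).smul (by positivity)
  · have h1 : ∀ Q, ((T Q).comp ((((Fintype.card (Bits ι) : ℝ)⁻¹ : ℝ) : ℂ) •
        (ofChoi ρ).comp (inducedMap (pauliString Q))) X).trace = (Fintype.card (Bits ι) : ℂ)⁻¹ *
          (ofChoi ρ (pauliString Q * X * (pauliString Q)ᴴ)).trace := by
      intro Q
      rw [LinearMap.comp_apply, (hT Q).2, LinearMap.smul_apply, Matrix.trace_smul,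
        smul_eq_mul, Complex.ofReal_inv, Complex.ofReal_natCast]
      rfl
    have h2 : (ofChoi ρ 1).trace = 1 := by
      rw [trace_ofChoi, ← hρ.2]
      simp [Matrix.one_apply, Fintype.sum_prod_type, Matrix.trace]
    simp only [h1, ← Finset.mul_sum, ← Matrix.trace_sum, ← map_sum, sum_pauliString_conj, map_smul,
      Matrix.trace_smul, h2, smul_eq_mul, mul_one]
    exact inv_mul_cancel_left₀ (by simp) _

variable {a b : Type} [Fintype a] [Fintype b]

lemma inducedMap_comp (U V : Matrix a a ℂ) :
    (inducedMap U).comp (inducedMap V) = inducedMap (U * V) := by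
  ext1 X
  simp [inducedMap, Matrix.conjTranspose_mul, mul_assoc]

/-- The superoperator with a given unnormalised Choi operator, ordered as in `bipartiteChoi`. -/
def ofBipartiteChoi (ω : Matrix ((a × a) × (b × b)) ((a × a) × (b × b)) ℂ) :
    SuperOp (a × b) (a × b) :=
  ofChoi (Matrix.reindex (Equiv.prodProdProdComm a b a b).symm
    (Equiv.prodProdProdComm a b a b).symm ω)

lemma ofBipartiteChoi_apply (ω : Matrix ((a × a) × (b × b)) ((a × a) × (b × b)) ℂ)
    (X : Matrix (a × b) (a × b) ℂ) (k l : a × b) :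
    ofBipartiteChoi ω X k l = ∑ p : (a × b) × (a × b), X p.1 p.2 *
      ω ((p.1.1, k.1), (p.1.2, k.2)) ((p.2.1, l.1), (p.2.2, l.2)) := rfl

lemma ofBipartiteChoi_sum_smul {ι : Type*} [Fintype ι] (r : ι → ℂ)
    (ω : ι → Matrix ((a × a) × (b × b)) ((a × a) × (b × b)) ℂ) :
    ofBipartiteChoi (∑ i, r i • ω i) = ∑ i, r i • ofBipartiteChoi (ω i) := by
  ext X k l
  simp only [ofBipartiteChoi_apply, LinearMap.sum_apply, LinearMap.smul_apply, Matrix.sum_apply,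
    Matrix.smul_apply, smul_eq_mul, Finset.mul_sum]
  rw [Finset.sum_comm]
  exact Finset.sum_congr rfl fun _ _ => Finset.sum_congr rfl fun _ _ => by ring

variable [DecidableEq a] [DecidableEq b]

lemma ofBipartiteChoi_kronecker (ρ : Matrix (a × a) (a × a) ℂ) (σ : Matrix (b × b) (b × b) ℂ) :
    ofBipartiteChoi (ρ ⊗ₖ σ) = tensorMap (ofChoi ρ) (ofChoi σ) := by
  refine linearMap_ext_kronecker fun x y => ?_
  rw [tensorMap_kronecker]
  ext k l
  simp only [ofBipartiteChoi_apply, Matrix.kroneckerMap_apply, ofChoi_apply, Finset.sum_mul_sum,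
    ← Fintype.sum_prod_type']
  rw [← Equiv.sum_comp (Equiv.prodProdProdComm a a b b)]
  refine Finset.sum_congr rfl fun p _ => ?_
  simp only [Equiv.prodProdProdComm_apply]
  ring

/-- The inverse dimension remains because the Choi operator is normalised while its inverse
transform is not; it is absorbed by the number of teleportation outcomes. -/
lemma ofBipartiteChoi_bipartiteChoi (Φ : SuperOp (a × b) (a × b)) :
    ofBipartiteChoi (bipartiteChoi Φ) = (Fintype.card (a × b) : ℂ)⁻¹ • Φ := by
  refine Matrix.ext_linearMap ℂ fun i j => ?_
  ext1
  change ofBipartiteChoi (bipartiteChoi Φ) (Matrix.single i j 1) =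
    (Fintype.card (a × b) : ℂ)⁻¹ • Φ (Matrix.single i j 1)
  ext k l
  rw [ofBipartiteChoi_apply, Fintype.sum_eq_single (i, j)]
  · simp [bipartiteChoi_apply]
  · rintro ⟨i', j'⟩ h
    have : Matrix.single i j (1 : ℂ) i' j' = 0 := by
      refine Matrix.single_apply_of_ne _ _ _ _ _ ?_
      rintro ⟨rfl, rfl⟩
      exact h rfl
    rw [this, zero_mul]

/-- The unitaries which map Pauli strings to products of local unitaries. -/
def MapsPauliToProduct {ι κ : Type} [Fintype ι] [DecidableEq ι] [Fintype κ]
    [DecidableEq κ]     (U : Matrix (Bits ι × Bits κ) (Bits ι × Bits κ) ℂ) : Prop :=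
  ∀ (P : ι → Fin 4) (Q : κ → Fin 4), ∃ (V : Matrix (Bits ι) (Bits ι) ℂ)
    (W : Matrix (Bits κ) (Bits κ) ℂ), V * Vᴴ = 1 ∧ W * Wᴴ = 1 ∧
      U * (pauliString P ⊗ₖ pauliString Q) * Uᴴ = V ⊗ₖ W

/-- The map `Λ` is teleportation through `ω`, summed over both parties' outcomes and corrected by
`V† ⊗ W†`. Being linear, it carries a separable decomposition of the Choi state to an LOCC
decomposition of the gate with the same coefficients. -/
theorem gamma_LOCC_le_gamma_SEP {n m : ℕ}
    {U : Matrix (Bits (Fin n) × Bits (Fin m)) (Bits (Fin n) × Bits (Fin m)) ℂ}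
    (hU : Uᴴ * U = 1) (hP : MapsPauliToProduct U) :
    gamma (LOCC (Bits (Fin n)) (Bits (Fin m))) (inducedMap U) ≤
      gamma (SEP (Bits (Fin n) × Bits (Fin n)) (Bits (Fin m) × Bits (Fin m)))
        (bipartiteChoi (inducedMap U)) := by
  choose V W hV hW hVW using hP
  let d₁ : ℝ := (Fintype.card (Bits (Fin n)))⁻¹
  let d₂ : ℝ := (Fintype.card (Bits (Fin m)))⁻¹
  let Λ : Matrix ((Bits (Fin n) × Bits (Fin n)) × (Bits (Fin m) × Bits (Fin m)))
      ((Bits (Fin n) × Bits (Fin n)) × (Bits (Fin m) × Bits (Fin m))) ℂ →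
      SuperOp (Bits (Fin n) × Bits (Fin m)) (Bits (Fin n) × Bits (Fin m)) := fun ω =>
    ∑ p : (Fin n → Fin 4) × (Fin m → Fin 4), ((d₁ * d₂ : ℝ) : ℂ) •
      (inducedMap ((V p.1 p.2)ᴴ ⊗ₖ (W p.1 p.2)ᴴ)).comp ((ofBipartiteChoi ω).comp
        (inducedMap (pauliString p.1 ⊗ₖ pauliString p.2)))
  have hΛsum : ∀ {ι : Type} [Fintype ι] (r : ι → ℂ) (ω : ι → _),
      Λ (∑ i, r i • ω i) = ∑ i, r i • Λ (ω i) := by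
    intro ι _ r ω
    simp only [Λ, ofBipartiteChoi_sum_smul, Finset.smul_sum]
    rw [Finset.sum_comm]
    refine Finset.sum_congr rfl fun p _ => ?_
    ext1 X
    simp only [LinearMap.smul_apply, LinearMap.comp_apply, LinearMap.sum_apply, map_sum, map_smul,
      Finset.smul_sum]
    exact Finset.sum_congr rfl fun i _ => smul_comm _ _ _
  have hΛU : Λ (bipartiteChoi (inducedMap U)) = inducedMap U := by
    -- Every outcome produces the same gate: `V† ⊗ W† = U (P ⊗ Q)† U†` cancels the error in `U (P ⊗
    -- Q)`.
    have h : ∀ p : (Fin n → Fin 4) × (Fin m → Fin 4),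
        (inducedMap ((V p.1 p.2)ᴴ ⊗ₖ (W p.1 p.2)ᴴ)).comp ((inducedMap U).comp
          (inducedMap (pauliString p.1 ⊗ₖ pauliString p.2))) = inducedMap U := by
      intro p
      rw [inducedMap_comp, inducedMap_comp, ← Matrix.conjTranspose_kronecker, ← hVW]
      congr 1
      simp only [Matrix.conjTranspose_mul, Matrix.conjTranspose_conjTranspose, mul_assoc]
      rw [← mul_assoc Uᴴ, hU, one_mul, Matrix.conjTranspose_kronecker, ← Matrix.mul_kronecker_mul,
        conjTranspose_mul_pauliString, conjTranspose_mul_pauliString, Matrix.one_kronecker_one,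
        mul_one]
    simp only [Λ, ofBipartiteChoi_bipartiteChoi, LinearMap.smul_comp, LinearMap.comp_smul, h]
    rw [Finset.sum_const, Finset.card_univ, smul_smul, ← Nat.cast_smul_eq_nsmul ℂ, smul_smul]
    -- There are `4 ^ (n + m)` outcomes, and both the probability factors and the Choi normalisation
    -- contribute `2 ^ (-(n + m))`.
    have hc : ((Fintype.card ((Fin n → Fin 4) × (Fin m → Fin 4)) : ℕ) : ℂ) *
        (((d₁ * d₂ : ℝ) : ℂ) * (Fintype.card (Bits (Fin n) × Bits (Fin m)) : ℂ)⁻¹) = 1 := by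
      simp only [d₁, d₂, Fintype.card_prod, Fintype.card_pi, Fintype.card_fin, Finset.prod_const,
        Finset.card_univ]
      push_cast
      rw [show (4 : ℂ) = 2 * 2 by norm_num, mul_pow, mul_pow]
      field_simp
    rw [hc, one_smul]
  -- The first party measures and announces `P`. The second measures `Q`, applies `W†`, which
  -- depends on both outcomes, and announces `Q`, so that the first can apply `V†`.
  have hΛmem : ∀ ρ σ, IsDensity ρ → IsDensity σ →
      Λ (ρ ⊗ₖ σ) ∈ LOCC (Bits (Fin n)) (Bits (Fin m)) := by
    intro ρ σ hρ hσ
    have h := sum_mem_LOCC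
      (isInstrument_teleport hρ fun _ : Fin n → Fin 4 => isChannel_id)
      (T := fun (P : Fin n → Fin 4) (Q : Fin m → Fin 4) => inducedMap (V P Q)ᴴ)
      (fun P Q => isChannel_inducedMap (by simpa using hV P Q))
      (fun P => isInstrument_teleport hσ fun Q => isChannel_inducedMap (U := (W P Q)ᴴ)
        (by simpa using hW P Q))
    convert h using 1
    refine Finset.sum_congr rfl fun p _ => ?_
    refine linearMap_ext_kronecker fun x y => ?_
    simp only [← tensorMap_inducedMap, ofBipartiteChoi_kronecker, LinearMap.smul_apply,
      LinearMap.comp_apply, tensorMap_kronecker, LinearMap.id_apply, map_smul,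
      Matrix.smul_kronecker, Matrix.kronecker_smul, smul_smul, Complex.ofReal_mul, d₁, d₂]
    rw [mul_comm]
  -- Each separable state is expanded into product states; as its weights sum to one, the total
  -- absolute weight stays the same.
  refine gamma_le_gamma fun k c F hk hF hJ => ?_
  choose l p ρ σ hp hp1 hρ hσ hF using hF
  have hc : ∑ q : Σ i, Fin (l i), |c q.1 * p q.1 q.2| = ∑ i, |c i| := by
    rw [Fintype.sum_sigma]
    refine Finset.sum_congr rfl fun i _ => ?_
    simp only [abs_mul, abs_of_nonneg (hp _ _), ← Finset.mul_sum, hp1, mul_one]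
  have : Nonempty (Σ i, Fin (l i)) := by
    obtain ⟨j, -⟩ : ∃ j, p ⟨0, hk⟩ j ≠ 0 := by
      by_contra! h
      simpa [h] using hp1 ⟨0, hk⟩
    exact ⟨⟨⟨0, hk⟩, j⟩⟩
  refine gamma_le_of_sum (fun q : Σ i, Fin (l i) => c q.1 * p q.1 q.2)
    (fun q => Λ (ρ q.1 q.2 ⊗ₖ σ q.1 q.2)) (fun q => hΛmem _ _ (hρ _ _) (hσ _ _)) ?_ hc.le
  rw [← hΛU, hJ, hΛsum, Fintype.sum_sigma]
  refine Finset.sum_congr rfl fun i _ => ?_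
  rw [hF, hΛsum, Finset.smul_sum]
  exact Finset.sum_congr rfl fun j _ => by rw [smul_smul, Complex.ofReal_mul]

/-! ### Clifford unitaries -/

lemma IsBipartiteClifford.conjTranspose_mul_self {n m : ℕ}
    {U : Matrix (Bits (Fin n) × Bits (Fin m)) (Bits (Fin n) × Bits (Fin m)) ℂ}
    (hU : IsBipartiteClifford U) : Uᴴ * U = 1 := by
  have h := Matrix.mem_unitaryGroup_iff'.1 hU.1
  rw [Matrix.star_eq_conjTranspose, Matrix.conjTranspose_reindex, Matrix.reindex_apply,
    Matrix.reindex_apply, Matrix.submatrix_mul_equiv] at h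
  have h2 := congrArg (fun M => Matrix.submatrix M
    (Equiv.sumArrowEquivProdArrow (Fin n) (Fin m) (Fin 2)).symm
    (Equiv.sumArrowEquivProdArrow (Fin n) (Fin m) (Fin 2)).symm) h
  simpa using h2

lemma pauliString_sum {n m : ℕ} (R : Fin n ⊕ Fin m → Fin 4) :
    (pauliString R).submatrix (Equiv.sumArrowEquivProdArrow (Fin n) (Fin m) (Fin 2)).symm
      (Equiv.sumArrowEquivProdArrow (Fin n) (Fin m) (Fin 2)).symm
      = pauliString (R ∘ Sum.inl) ⊗ₖ pauliString (R ∘ Sum.inr) := by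
  ext x y
  simp [pauliString, Matrix.kroneckerMap_apply, Fintype.prod_sum_type,
    Equiv.sumArrowEquivProdArrow]

/-- The image is a phase times a Pauli string, which splits into its restrictions to the two
registers; the phase goes into `V`. -/
lemma IsBipartiteClifford.mapsPauliToProduct {n m : ℕ}
    {U : Matrix (Bits (Fin n) × Bits (Fin m)) (Bits (Fin n) × Bits (Fin m)) ℂ}
    (hU : IsBipartiteClifford U) : MapsPauliToProduct U := by
  intro P Q
  obtain ⟨c, R, hR⟩ := hU.2 (pauliString (Sum.elim P Q)) ⟨0, Sum.elim P Q, by simp⟩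
  let e := Equiv.sumArrowEquivProdArrow (Fin n) (Fin m) (Fin 2)
  have h2 := congrArg (fun M => Matrix.submatrix M e.symm e.symm) hR
  have hPQ := pauliString_sum (Sum.elim P Q)
  simp only [Sum.elim_comp_inl, Sum.elim_comp_inr] at hPQ
  refine ⟨Complex.I ^ (c : ℕ) • pauliString (R ∘ Sum.inl), pauliString (R ∘ Sum.inr), ?_, ?_, ?_⟩
  · rw [Matrix.conjTranspose_smul, Matrix.smul_mul, Matrix.mul_smul, smul_smul,
      pauliString_mul_conjTranspose]
    have : Complex.I ^ (c : ℕ) * star (Complex.I ^ (c : ℕ)) = 1 := by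
      rw [Complex.star_def, Complex.mul_conj']
      simp
    rw [this, one_smul]
  · exact pauliString_mul_conjTranspose _
  · rw [Matrix.smul_kronecker, ← pauliString_sum, ← hPQ]
    refine Eq.trans ?_ h2
    rw [Matrix.conjTranspose_reindex]
    simp only [Matrix.reindex_apply, Equiv.symm_symm]
    rw [← Matrix.submatrix_mul_equiv _ _ _ e.symm _, ← Matrix.submatrix_mul_equiv _ _ _ e.symm _]
    simp [e]

end Teleportation

/-! ### The extent of maximally entangled states -/

section MaxEntangled

/-- The vector of phases given by cube roots of unity. -/
def phase {ι : Type} (s : ι → ZMod 3) : ι → ℂ := fun i => ZMod.stdAddChar (s i)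

lemma star_phase_mul_phase {ι : Type} (s : ι → ZMod 3) (i : ι) : star (phase s i) * phase s i = 1 := by
  rw [phase, Complex.star_def, ← AddChar.map_neg_eq_conj, ← AddChar.map_add_eq_mul, neg_add_cancel,
    AddChar.map_zero_eq_one]

variable {ι α β : Type} [Fintype ι]

/-- The vector `∑ i, e i ⊗ f i`, where `e i` and `f i` are the columns of `E` and `F`. -/
def schmidtVector (E : Matrix α ι ℂ) (F : Matrix β ι ℂ) : α × β → ℂ :=
  fun p => ∑ i, E p.1 i * F p.2 i

/-- The pure state of the vector `(card ι) ^ (-1/2) ∑ i, e i ⊗ f i`. -/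
def schmidtState (E : Matrix α ι ℂ) (F : Matrix β ι ℂ) : Matrix (α × β) (α × β) ℂ :=
  (Fintype.card ι : ℂ)⁻¹ • Matrix.vecMulVec (schmidtVector E F) (star (schmidtVector E F))

/-- With `R = C† C` and `S = D† D` the sum is the squared Frobenius norm of `C Dᵀ`, so it is
nonnegative, and Cauchy–Schwarz bounds it. -/
lemma sum_mul_le_trace_mul_trace {R S : Matrix ι ι ℂ} (hR : R.PosSemidef) (hS : S.PosSemidef) :
    0 ≤ (∑ i, ∑ j, R i j * S i j).re ∧
      (∑ i, ∑ j, R i j * S i j).re ≤ R.trace.re * S.trace.re := by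
  obtain ⟨C, rfl⟩ := exists_eq_conjTranspose_mul_self hR
  obtain ⟨D, rfl⟩ := exists_eq_conjTranspose_mul_self hS
  have h : ∑ i, ∑ j, (Cᴴ * C) i j * (Dᴴ * D) i j
      = ((∑ k, ∑ l, ‖∑ i, C k i * D l i‖ ^ 2 : ℝ) : ℂ) := by
    have h1 : ∀ k l, ((‖∑ i, C k i * D l i‖ ^ 2 : ℝ) : ℂ) =
        ∑ i, ∑ j, (star (C k i) * C k j) * (star (D l i) * D l j) := by
      intro k l
      rw [Complex.ofReal_pow, ← Complex.conj_mul', ← Complex.star_def, star_sum, Finset.sum_mul_sum]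
      refine Finset.sum_congr rfl fun i _ => Finset.sum_congr rfl fun j _ => ?_
      rw [star_mul']
      ring
    simp only [Complex.ofReal_sum, h1, Matrix.mul_apply, Matrix.conjTranspose_apply,
      Finset.sum_mul_sum]
    have h2 : ∀ f : ι → ι → ι → ι → ℂ, ∑ i, ∑ j, ∑ k, ∑ l, f i j k l
        = ∑ k, ∑ l, ∑ i, ∑ j, f i j k l := by
      intro f
      simp only [← Fintype.sum_prod_type']
      exact Fintype.sum_equiv ⟨fun x => (x.2.2.1, x.2.2.2, x.1, x.2.1),
        fun x => (x.2.2.1, x.2.2.2, x.1, x.2.1), fun _ => rfl, fun _ => rfl⟩ _ _ fun _ => rfl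
    exact h2 _
  rw [h, Complex.ofReal_re, trace_conjTranspose_mul_self_eq, trace_conjTranspose_mul_self_eq,
    Complex.ofReal_re, Complex.ofReal_re]
  refine ⟨by positivity, ?_⟩
  rw [Finset.sum_comm (f := fun j i => ‖C i j‖ ^ 2), Finset.sum_comm (f := fun j i => ‖D i j‖ ^ 2),
    Finset.sum_mul_sum]
  refine Finset.sum_le_sum fun k _ => Finset.sum_le_sum fun l _ => ?_
  have h3 : ‖∑ i, C k i * D l i‖ ≤ ∑ i, ‖C k i‖ * ‖D l i‖ :=
    (norm_sum_le _ _).trans_eq (by simp only [norm_mul])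
  exact (pow_le_pow_left₀ (norm_nonneg _) h3 2).trans (Finset.sum_mul_sq_le_sq_mul_sq _ _ _)

variable [DecidableEq ι]

/-- Orthogonality of characters: the average is one exactly when `e i - e j - e k + e l` vanishes.
Cube roots are used because with signs the pairing `i = l`, `j = k` would contribute as well; modulo
3 it leaves `2 (e i - e j)`, which is zero only if `i = j`. -/
lemma sum_phase (i j k l : ι) :
    ∑ s : ι → ZMod 3, phase s i * star (phase s j) * (star (phase s k) * phase s l)
      = (Fintype.card (ι → ZMod 3) : ℂ) *
        ((if i = k ∧ j = l then 1 else 0) + if i = j ∧ k = l ∧ i ≠ k then 1 else 0) := by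
  let e : ι → (ι → ZMod 3) →+ ZMod 3 := Pi.evalAddMonoidHom _
  let h : (ι → ZMod 3) →+ ZMod 3 := e i - e j - e k + e l
  let ψ : AddChar (ι → ZMod 3) ℂ := ZMod.stdAddChar.compAddMonoidHom h
  have hh : ∀ s, h s = s i - s j - s k + s l := fun s => rfl
  have hψ : ∀ s, phase s i * star (phase s j) * (star (phase s k) * phase s l) = ψ s := by
    intro s
    simp only [ψ, AddChar.compAddMonoidHom_apply, hh, phase, Complex.star_def,
      ← AddChar.map_neg_eq_conj, ← AddChar.map_add_eq_mul]
    congr 1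
    ring
  simp only [hψ]
  rw [AddChar.sum_eq_ite]
  by_cases h0 : h = 0
  · have hψ0 : ψ = 0 := by
      ext s
      simp [ψ, h0]
    rw [if_pos hψ0]
    by_cases hik : i = k
    · subst hik
      have hjl : j = l := by
        by_contra hjl
        have := DFunLike.congr_fun h0 (Pi.single l 1)
        rw [hh] at this
        by_cases hil : i = l <;> simp_all
      simp [hjl]
    · have hij : i = j := by
        by_contra hij
        have := DFunLike.congr_fun h0 (Pi.single i 1)
        rw [hh] at this
        by_cases hil : l = i
        · simp [hil, Ne.symm hik, Ne.symm hij] at this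
          -- Here the coefficient at `i` is `1 + 1`, nonzero modulo 3.
          revert this
          decide
        · simp [hil, Ne.symm hik, Ne.symm hij] at this
      subst hij
      have hkl : k = l := by
        by_contra hkl
        have := DFunLike.congr_fun h0 (Pi.single l 1)
        rw [hh] at this
        simp [hkl, Pi.single_apply] at this
      simp [hkl]
      split_ifs <;> simp
  · have hψ0 : ψ ≠ 0 := by
      intro hψ0
      refine h0 (AddMonoidHom.ext fun s => ?_)
      have h1 : ZMod.stdAddChar (h s) = (1 : ℂ) := DFunLike.congr_fun hψ0 s
      rw [← AddChar.map_zero_eq_one (ZMod.stdAddChar (N := 3))] at h1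
      exact ZMod.injective_stdAddChar h1
    rw [if_neg hψ0, if_neg, if_neg]
    · simp
    · rintro ⟨rfl, rfl, -⟩
      apply h0
      ext s
      simp [hh]
    · rintro ⟨rfl, rfl⟩
      apply h0
      ext s
      simp [hh]

lemma sum_mul_coincidence (g : ι → ι → ι → ι → ℂ) :
    ∑ i, ∑ j, ∑ k, ∑ l, g i j k l *
        ((if i = k ∧ j = l then 1 else 0) + if i = j ∧ k = l ∧ i ≠ k then 1 else 0)
      = ∑ i, ∑ j, g i j i j + ∑ i, ∑ k, if i ≠ k then g i i k k else 0 := by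
  simp only [mul_add, Finset.sum_add_distrib]
  congr 1
  · refine Finset.sum_congr rfl fun i _ => Finset.sum_congr rfl fun j _ => ?_
    rw [Fintype.sum_eq_single i fun k hk => by simp [hk.symm],
      Fintype.sum_eq_single j fun l hl => by simp [hl.symm]]
    simp
  · refine Finset.sum_congr rfl fun i _ => ?_
    rw [Fintype.sum_eq_single i fun j hj => by simp [hj.symm]]
    refine Finset.sum_congr rfl fun k _ => ?_
    rw [Fintype.sum_eq_single k fun l hl => by simp [hl.symm]]
    simp

/-- Averaging over conjugate random phases on the two sides keeps the coherent terms `i = k`, `j =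
l`, which form the entangled state, and the terms `i = j`, `k = l` with `i ≠ k`, a mixture of
product states `e i ⊗ f k` that is subtracted again. -/
lemma schmidtState_decomposition [Nonempty ι] (E : Matrix α ι ℂ) (F : Matrix β ι ℂ) :
    schmidtState E F = (∑ s : ι → ZMod 3, ((Fintype.card ι : ℂ) / Fintype.card (ι → ZMod 3)) •
        (((Fintype.card ι : ℂ)⁻¹ • Matrix.vecMulVec (E *ᵥ phase s) (star (E *ᵥ phase s))) ⊗ₖ
          ((Fintype.card ι : ℂ)⁻¹ • Matrix.vecMulVec (F *ᵥ star (phase s))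
            (star (F *ᵥ star (phase s)))))) +
      ∑ p : ι × ι, (if p.1 ≠ p.2 then -(Fintype.card ι : ℂ)⁻¹ else 0) •
        (Matrix.vecMulVec (E.col p.1) (star (E.col p.1)) ⊗ₖ
          Matrix.vecMulVec (F.col p.2) (star (F.col p.2))) := by
  have hd : (Fintype.card ι : ℂ) ≠ 0 := by simp
  have hD : (Fintype.card (ι → ZMod 3) : ℂ) ≠ 0 := by simp
  ext ⟨p, q⟩ ⟨p', q'⟩
  have hmain : ∑ s : ι → ZMod 3, ((∑ i, E p i * phase s i) * star (∑ j, E p' j * phase s j)) *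
      ((∑ k, F q k * star (phase s k)) * star (∑ l, F q' l * star (phase s l)))
      = (Fintype.card (ι → ZMod 3) : ℂ) * ((∑ i, E p i * F q i) * star (∑ j, E p' j * F q' j) +
        ∑ i, ∑ k, if i ≠ k then E p i * star (E p' i) * (F q k * star (F q' k)) else 0) := by
    have h1 : ∀ s : ι → ZMod 3, ((∑ i, E p i * phase s i) * star (∑ j, E p' j * phase s j)) *
        ((∑ k, F q k * star (phase s k)) * star (∑ l, F q' l * star (phase s l)))
        = ∑ x : ι × ι × ι × ι, (E p x.1 * star (E p' x.2.1) * (F q x.2.2.1 * star (F q' x.2.2.2))) *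
          (phase s x.1 * star (phase s x.2.1) * (star (phase s x.2.2.1) * phase s x.2.2.2)) := by
      intro s
      simp only [Fintype.sum_prod_type, star_sum, star_mul', star_star, Finset.sum_mul_sum]
      refine Finset.sum_congr rfl fun i _ => ?_
      rw [Finset.sum_comm]
      refine Finset.sum_congr rfl fun j _ => Finset.sum_congr rfl fun k _ =>
        Finset.sum_congr rfl fun l _ => ?_
      ring
    simp only [h1]
    rw [Finset.sum_comm]
    have h2 : ∀ x : ι × ι × ι × ι, ∑ s : ι → ZMod 3,
        (E p x.1 * star (E p' x.2.1) * (F q x.2.2.1 * star (F q' x.2.2.2))) *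
          (phase s x.1 * star (phase s x.2.1) * (star (phase s x.2.2.1) * phase s x.2.2.2)) =
        (Fintype.card (ι → ZMod 3) : ℂ) *
          ((E p x.1 * star (E p' x.2.1) * (F q x.2.2.1 * star (F q' x.2.2.2))) *
          ((if x.1 = x.2.2.1 ∧ x.2.1 = x.2.2.2 then 1 else 0) +
            if x.1 = x.2.1 ∧ x.2.2.1 = x.2.2.2 ∧ x.1 ≠ x.2.2.1 then 1 else 0)) := fun x => by
      rw [← Finset.mul_sum, sum_phase, mul_left_comm]
    rw [Finset.sum_congr rfl fun x _ => h2 x, ← Finset.mul_sum]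
    simp only [Fintype.sum_prod_type]
    rw [sum_mul_coincidence fun i j k l => E p i * star (E p' j) * (F q k * star (F q' l))]
    simp only [star_sum, star_mul', Finset.sum_mul_sum]
    congr 2
    exact Finset.sum_congr rfl fun i _ => Finset.sum_congr rfl fun j _ => by ring
  have hoff : ∑ x : ι × ι, (if x.1 ≠ x.2 then -(Fintype.card ι : ℂ)⁻¹ else 0) *
        (E p x.1 * star (E p' x.1) * (F q x.2 * star (F q' x.2)))
      = -(Fintype.card ι : ℂ)⁻¹ * ∑ i, ∑ k, if i ≠ k then
        E p i * star (E p' i) * (F q k * star (F q' k)) else 0 := by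
    simp only [Fintype.sum_prod_type, Finset.mul_sum, ite_mul, zero_mul, mul_ite, mul_zero]
  have hphase : ∑ s : ι → ZMod 3, ((Fintype.card ι : ℂ) / Fintype.card (ι → ZMod 3)) *
      ((Fintype.card ι : ℂ)⁻¹ * ((∑ i, E p i * phase s i) * star (∑ j, E p' j * phase s j)) *
      ((Fintype.card ι : ℂ)⁻¹ * ((∑ k, F q k * star (phase s k)) *
        star (∑ l, F q' l * star (phase s l)))))
      = (Fintype.card ι : ℂ)⁻¹ * ((∑ i, E p i * F q i) * star (∑ j, E p' j * F q' j) +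
        ∑ i, ∑ k, if i ≠ k then E p i * star (E p' i) * (F q k * star (F q' k)) else 0) := by
    have h : ∀ x y : ℂ, (Fintype.card ι : ℂ) / Fintype.card (ι → ZMod 3) *
        ((Fintype.card ι : ℂ)⁻¹ * x * ((Fintype.card ι : ℂ)⁻¹ * y)) =
        (Fintype.card ι : ℂ)⁻¹ / Fintype.card (ι → ZMod 3) * (x * y) := by
      intro x y
      field_simp
    rw [Finset.sum_congr rfl fun s _ => h _ _, ← Finset.mul_sum, hmain]
    field_simp
  simp only [schmidtState, Matrix.add_apply, Matrix.sum_apply, Matrix.smul_apply, smul_eq_mul,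
    Matrix.kroneckerMap_apply, Matrix.vecMulVec_apply, schmidtVector, Pi.star_apply,
    Matrix.mulVec, dotProduct, Matrix.col_apply]
  rw [hphase, hoff]
  ring

variable [Fintype α] [Fintype β]

lemma isDensity_pure {v : α → ℂ} (hv : star v ⬝ᵥ v = 1) :
    IsDensity (Matrix.vecMulVec v (star v)) := by
  refine ⟨Matrix.posSemidef_vecMulVec_self_star _, ?_⟩
  rw [Matrix.trace_vecMulVec, dotProduct_comm, hv]

lemma star_mulVec_dotProduct {E : Matrix α ι ℂ} (hE : Eᴴ * E = 1) (v : ι → ℂ) :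
    star (E *ᵥ v) ⬝ᵥ (E *ᵥ v) = star v ⬝ᵥ v := by
  rw [Matrix.star_mulVec, Matrix.dotProduct_mulVec, Matrix.vecMul_vecMul, hE, Matrix.vecMul_one]

lemma isDensity_phase [Nonempty ι] {E : Matrix α ι ℂ} (hE : Eᴴ * E = 1) {v : ι → ℂ}
    (hv : ∀ i, star (v i) * v i = 1) :
    IsDensity ((Fintype.card ι : ℂ)⁻¹ • Matrix.vecMulVec (E *ᵥ v) (star (E *ᵥ v))) := by
  refine ⟨(Matrix.posSemidef_vecMulVec_self_star _).smul ?_, ?_⟩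
  · have : (0 : ℝ) ≤ (Fintype.card ι : ℝ)⁻¹ := by positivity
    have h2 := Complex.zero_le_real.2 this
    rwa [Complex.ofReal_inv, Complex.ofReal_natCast] at h2
  · rw [Matrix.trace_smul, Matrix.trace_vecMulVec, dotProduct_comm, star_mulVec_dotProduct hE]
    simp only [dotProduct, Pi.star_apply, hv, Finset.sum_const, Finset.card_univ, nsmul_eq_mul,
      mul_one, smul_eq_mul]
    exact inv_mul_cancel₀ (by simp)

/-- With `d = card ι`, the phase average has total weight `d`, and the `d (d - 1)` subtracted
products have weight `1 / d` each, which makes `d + (d - 1)`. -/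
lemma gamma_schmidtState_le [Nonempty ι] {E : Matrix α ι ℂ} {F : Matrix β ι ℂ}
    (hE : Eᴴ * E = 1) (hF : Fᴴ * F = 1) :
    gamma (SEP α β) (schmidtState E F) ≤ ENNReal.ofReal (2 * Fintype.card ι - 1) := by
  have hd : (Fintype.card ι : ℝ) ≠ 0 := by simp
  have hD : (Fintype.card (ι → ZMod 3) : ℝ) ≠ 0 := by simp
  have hcol : ∀ {γ : Type} [Fintype γ] {E : Matrix γ ι ℂ}, Eᴴ * E = 1 → ∀ i,
      star (E.col i) ⬝ᵥ E.col i = 1 := by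
    intro γ _ E hE i
    have := congrFun (congrFun hE i) i
    rwa [Matrix.one_apply_eq] at this
  refine gamma_le_of_sum (ι := (ι → ZMod 3) ⊕ (ι × ι))
    (Sum.elim (fun _ => (Fintype.card ι : ℝ) / Fintype.card (ι → ZMod 3))
      fun p => if p.1 ≠ p.2 then -(Fintype.card ι : ℝ)⁻¹ else 0)
    (Sum.elim (fun s =>
        ((Fintype.card ι : ℂ)⁻¹ • Matrix.vecMulVec (E *ᵥ phase s) (star (E *ᵥ phase s))) ⊗ₖ
          ((Fintype.card ι : ℂ)⁻¹ • Matrix.vecMulVec (F *ᵥ star (phase s))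
            (star (F *ᵥ star (phase s)))))
      fun p => Matrix.vecMulVec (E.col p.1) (star (E.col p.1)) ⊗ₖ
          Matrix.vecMulVec (F.col p.2) (star (F.col p.2))) ?_ ?_ ?_
  · rintro (s | p)
    · refine kronecker_mem_SEP (isDensity_phase hE (star_phase_mul_phase s))
        (isDensity_phase hF fun i => ?_)
      rw [Pi.star_apply, star_star, mul_comm, star_phase_mul_phase]
    · exact kronecker_mem_SEP (isDensity_pure (hcol hE _)) (isDensity_pure (hcol hF _))
  · rw [schmidtState_decomposition, Fintype.sum_sum_type]
    congr 1
    · simp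
    · refine Finset.sum_congr rfl fun p _ => ?_
      congr 1
      simp only [Sum.elim_inr]
      split_ifs <;> simp
  · rw [Fintype.sum_sum_type]
    simp only [Sum.elim_inl, Sum.elim_inr]
    have h1 : ∑ _s : ι → ZMod 3, |(Fintype.card ι : ℝ) / Fintype.card (ι → ZMod 3)|
        = Fintype.card ι := by
      rw [abs_of_nonneg (by positivity), Finset.sum_const, Finset.card_univ, nsmul_eq_mul,
        mul_div_cancel₀ _ hD]
    have h2 : ∑ p : ι × ι, |if p.1 ≠ p.2 then -(Fintype.card ι : ℝ)⁻¹ else 0|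
        = Fintype.card ι - 1 := by
      have h3 : ∀ p : ι × ι, |if p.1 ≠ p.2 then -(Fintype.card ι : ℝ)⁻¹ else 0|
          = (Fintype.card ι : ℝ)⁻¹ - if p.1 = p.2 then (Fintype.card ι : ℝ)⁻¹ else 0 := by
        intro p
        by_cases hp : p.1 = p.2 <;> simp [hp]
      simp only [h3, Finset.sum_sub_distrib, Fintype.sum_prod_type, Finset.sum_const,
        Finset.card_univ, nsmul_eq_mul, Finset.sum_ite_eq, Finset.mem_univ, if_true,
        Fintype.card_prod, Nat.cast_mul]
      field_simp
    rw [h1, h2]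
    linarith

/-! ### Lower bound by overlap with the maximally entangled vector -/

lemma trace_conjTranspose_mul_mul_le [DecidableEq α] {E : Matrix α ι ℂ} (hE : Eᴴ * E = 1)
    {ρ : Matrix α α ℂ} (hρ : ρ.PosSemidef) : (Eᴴ * ρ * E).trace.re ≤ ρ.trace.re := by
  have hQ : (1 - E * Eᴴ) * (1 - E * Eᴴ) = 1 - E * Eᴴ := by
    have : E * Eᴴ * (E * Eᴴ) = E * Eᴴ := by
      rw [Matrix.mul_assoc, ← Matrix.mul_assoc Eᴴ, hE, Matrix.one_mul]
    noncomm_ring [this]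
  have hQ' : (1 - E * Eᴴ)ᴴ = 1 - E * Eᴴ := by
    simp [Matrix.conjTranspose_sub, Matrix.conjTranspose_mul]
  -- `1 - E E†` is an orthogonal projection, and the trace of `ρ` compressed to it is exactly the
  -- difference of the two sides.
  have h := (hρ.conjTranspose_mul_mul_same (1 - E * Eᴴ)).trace_nonneg
  rw [hQ', mul_assoc, Matrix.trace_mul_comm, mul_assoc, hQ, mul_sub, mul_one, Matrix.trace_sub,
    ← Matrix.mul_assoc, Matrix.trace_mul_comm (ρ * E), ← Matrix.mul_assoc] at h
  have := (Complex.nonneg_iff.1 h).1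
  rw [Complex.sub_re] at this
  linarith

lemma dotProduct_kronecker_mulVec_schmidtVector (E : Matrix α ι ℂ) (F : Matrix β ι ℂ)
    (ρ : Matrix α α ℂ) (σ : Matrix β β ℂ) :
    star (schmidtVector E F) ⬝ᵥ ((ρ ⊗ₖ σ) *ᵥ schmidtVector E F)
      = ∑ i, ∑ j, (Eᴴ * ρ * E) i j * (Fᴴ * σ * F) i j := by
  let δ : ι × ι → ℂ := fun p => if p.1 = p.2 then 1 else 0
  have h : schmidtVector E F = (E ⊗ₖ F) *ᵥ δ := by
    ext p
    simp [schmidtVector, Matrix.mulVec, dotProduct, δ, Fintype.sum_prod_type]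
  rw [h, Matrix.mulVec_mulVec, Matrix.star_mulVec, Matrix.dotProduct_mulVec, Matrix.vecMul_vecMul,
    Matrix.conjTranspose_kronecker, ← Matrix.mul_kronecker_mul, ← Matrix.mul_kronecker_mul,
    ← Matrix.mul_assoc, ← Matrix.mul_assoc, ← Matrix.dotProduct_mulVec]
  simp [Matrix.mulVec, dotProduct, δ, Fintype.sum_prod_type]

/-- The overlap of an operator with the (unnormalised) vector `∑ i, e i ⊗ f i`. -/
def overlap (E : Matrix α ι ℂ) (F : Matrix β ι ℂ) : Matrix (α × β) (α × β) ℂ →ₗ[ℂ] ℂ where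
  toFun ω := star (schmidtVector E F) ⬝ᵥ (ω *ᵥ schmidtVector E F)
  map_add' x y := by rw [Matrix.add_mulVec, dotProduct_add]
  map_smul' c x := by rw [Matrix.smul_mulVec, dotProduct_smul]; rfl

/-- On a product state the overlap is `∑ R i j * S i j` for the compressions `R = E† ρ E` and `S =
F† σ F`, whose traces are at most one; convexity does the rest. -/
lemma overlap_mem_Icc [DecidableEq α] [DecidableEq β] {E : Matrix α ι ℂ} {F : Matrix β ι ℂ}
    (hE : Eᴴ * E = 1) (hF : Fᴴ * F = 1) {ω : Matrix (α × β) (α × β) ℂ} (hω : ω ∈ SEP α β) :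
    (overlap E F ω).re ∈ Set.Icc (0 : ℝ) 1 := by
  obtain ⟨m, p, ρ, σ, hp, hp1, hρ, hσ, rfl⟩ := hω
  have h : ∀ i, (overlap E F (ρ i ⊗ₖ σ i)).re ∈ Set.Icc (0 : ℝ) 1 := by
    intro i
    have h1 : overlap E F (ρ i ⊗ₖ σ i) = _ :=
      dotProduct_kronecker_mulVec_schmidtVector E F (ρ i) (σ i)
    have hR := (hρ i).1.conjTranspose_mul_mul_same E
    have hS := (hσ i).1.conjTranspose_mul_mul_same F
    have h2 := sum_mul_le_trace_mul_trace hR hS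
    rw [h1]
    refine ⟨h2.1, h2.2.trans ?_⟩
    have h3 := trace_conjTranspose_mul_mul_le hE (hρ i).1
    have h4 := trace_conjTranspose_mul_mul_le hF (hσ i).1
    rw [(hρ i).2, Complex.one_re] at h3
    rw [(hσ i).2, Complex.one_re] at h4
    exact mul_le_one₀ h3 (Complex.nonneg_iff.1 hS.trace_nonneg).1 h4
  simp only [map_sum, map_smul, smul_eq_mul, Complex.re_sum, Complex.re_ofReal_mul]
  refine ⟨Finset.sum_nonneg fun i _ => mul_nonneg (hp i) (h i).1, ?_⟩
  rw [← hp1]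
  exact Finset.sum_le_sum fun i _ => mul_le_of_le_one_right (hp i) (h i).2

lemma dotProduct_schmidtVector {E : Matrix α ι ℂ} {F : Matrix β ι ℂ}
    (hE : Eᴴ * E = 1) (hF : Fᴴ * F = 1) :
    star (schmidtVector E F) ⬝ᵥ schmidtVector E F = Fintype.card ι := by
  classical
  have h := dotProduct_kronecker_mulVec_schmidtVector E F 1 1
  rw [Matrix.one_kronecker_one, Matrix.one_mulVec, Matrix.mul_one, Matrix.mul_one, hE, hF] at h
  rw [h]
  simp [Matrix.one_apply]

/-- The dual witness is twice the overlap minus the trace: it lies in `[-1, 1]` on separable states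
and equals `2 d - 1` on this state, where `d = card ι`. -/
lemma le_gamma_schmidtState [Nonempty ι] [DecidableEq α] [DecidableEq β] {E : Matrix α ι ℂ}
    {F : Matrix β ι ℂ} (hE : Eᴴ * E = 1) (hF : Fᴴ * F = 1) :
    ENNReal.ofReal (2 * Fintype.card ι - 1) ≤ gamma (SEP α β) (schmidtState E F) := by
  refine le_sInf ?_
  rintro r ⟨m, c, ω, hm, hω, hS, rfl⟩
  refine ENNReal.ofReal_le_ofReal ?_
  have hd : (Fintype.card ι : ℂ) ≠ 0 := by simp
  have htr : (schmidtState E F).trace = 1 := by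
    rw [schmidtState, Matrix.trace_smul, Matrix.trace_vecMulVec, dotProduct_comm,
      dotProduct_schmidtVector hE hF, smul_eq_mul, inv_mul_cancel₀ hd]
  have hov : overlap E F (schmidtState E F) = Fintype.card ι := by
    change star (schmidtVector E F) ⬝ᵥ (schmidtState E F *ᵥ schmidtVector E F) = _
    rw [schmidtState, Matrix.smul_mulVec, Matrix.vecMulVec_mulVec, dotProduct_smul,
      dotProduct_schmidtVector hE hF, dotProduct_smul, dotProduct_schmidtVector hE hF]
    simp
  have h1 : ∑ i, c i = 1 := by
    have := congrArg Matrix.trace hS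
    rw [htr, Matrix.trace_sum] at this
    simp only [Matrix.trace_smul, trace_of_mem_SEP (hω _), smul_eq_mul, mul_one] at this
    exact_mod_cast this.symm
  have h2 : ∑ i, c i * (overlap E F (ω i)).re = Fintype.card ι := by
    have := congrArg (fun M => (overlap E F M).re) hS
    simp only [hov, map_sum, map_smul, smul_eq_mul, Complex.re_sum, Complex.re_ofReal_mul,
      Complex.natCast_re] at this
    exact this.symm
  have h3 : ∀ i, 2 * (c i * (overlap E F (ω i)).re) ≤ |c i| + c i := by
    intro i
    have h4 := overlap_mem_Icc hE hF (hω i)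
    rcases le_total 0 (c i) with h | h
    · rw [abs_of_nonneg h]
      nlinarith [mul_le_of_le_one_right h h4.2]
    · rw [abs_of_nonpos h]
      nlinarith [mul_nonpos_of_nonpos_of_nonneg h h4.1]
  have h5 := Finset.sum_le_sum fun i (_ : i ∈ Finset.univ) => h3 i
  rw [← Finset.mul_sum, Finset.sum_add_distrib, h1, h2] at h5
  linarith

theorem gamma_schmidtState [Nonempty ι] {E : Matrix α ι ℂ} {F : Matrix β ι ℂ}
    (hE : Eᴴ * E = 1) (hF : Fᴴ * F = 1) :
    gamma (SEP α β) (schmidtState E F) = ENNReal.ofReal (2 * Fintype.card ι - 1) := by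
  classical
  exact (gamma_schmidtState_le hE hF).antisymm (le_gamma_schmidtState hE hF)

end MaxEntangled

/-! ### Two-qubit gates -/

section Gates

/-- Assumes only the product property and not the Clifford one, so the concrete gates can be treated
by checking Pauli images directly. -/
theorem gamma_LOCCStar_eq_gamma_SEP {n m : ℕ}
    {U : Matrix (Bits (Fin n) × Bits (Fin m)) (Bits (Fin n) × Bits (Fin m)) ℂ}
    (hU : Uᴴ * U = 1) (hP : MapsPauliToProduct U) :
    gamma (LOCCStar (Bits (Fin n)) (Bits (Fin m))) (inducedMap U)
        = gamma (LOCC (Bits (Fin n)) (Bits (Fin m))) (inducedMap U) ∧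
      gamma (LOCC (Bits (Fin n)) (Bits (Fin m))) (inducedMap U)
        = gamma (SEP (Bits (Fin n) × Bits (Fin n)) (Bits (Fin m) × Bits (Fin m)))
            (bipartiteChoi (inducedMap U)) := by
  have h1 : gamma (LOCCStar (Bits (Fin n)) (Bits (Fin m))) (inducedMap U)
      ≤ gamma (LOCC (Bits (Fin n)) (Bits (Fin m))) (inducedMap U) := by
    refine gamma_mono ?_ _
    rintro Φ ⟨Θ, E, hE, hΦ⟩
    exact ⟨Θ, E, fun _ => 1, hE, fun _ => by norm_num, by simpa using hΦ⟩
  have h2 := gamma_LOCC_le_gamma_SEP hU hP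
  have h3 := gamma_SEP_le_gamma_LOCCStar (inducedMap U)
  exact ⟨h1.antisymm (h2.trans h3), h2.antisymm (h3.trans h1)⟩

/-- The matrix of the tensor product of one-qubit operators. -/
def kron4 (A B : Matrix (Fin 2) (Fin 2) ℂ) : Matrix (Fin 4) (Fin 4) ℂ :=
  Matrix.reindex finProdFinEquiv finProdFinEquiv (A ⊗ₖ B)

/-- The equivalence underlying `twoQubitGate`. -/
def bitsEquiv : Bits (Fin 1) × Bits (Fin 1) ≃ Fin 4 :=
  ((Equiv.funUnique (Fin 1) (Fin 2)).prodCongr (Equiv.funUnique (Fin 1) (Fin 2))).trans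
    finProdFinEquiv

lemma twoQubitGate_eq (M : Matrix (Fin 4) (Fin 4) ℂ) :
    twoQubitGate M = M.submatrix bitsEquiv bitsEquiv := rfl

lemma twoQubitGate_mul (M N : Matrix (Fin 4) (Fin 4) ℂ) :
    twoQubitGate (M * N) = twoQubitGate M * twoQubitGate N := by
  simp only [twoQubitGate_eq, Matrix.submatrix_mul_equiv]

lemma twoQubitGate_conjTranspose (M : Matrix (Fin 4) (Fin 4) ℂ) :
    (twoQubitGate M)ᴴ = twoQubitGate Mᴴ := rfl

lemma twoQubitGate_one : twoQubitGate 1 = 1 := by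
  rw [twoQubitGate_eq, Matrix.submatrix_one_equiv]

/-- One-qubit operators as operators on a register of one qubit. -/
def oneQubitGate (A : Matrix (Fin 2) (Fin 2) ℂ) : Matrix (Bits (Fin 1)) (Bits (Fin 1)) ℂ :=
  A.submatrix (Equiv.funUnique (Fin 1) (Fin 2)) (Equiv.funUnique (Fin 1) (Fin 2))

lemma oneQubitGate_kronecker (A B : Matrix (Fin 2) (Fin 2) ℂ) :
    oneQubitGate A ⊗ₖ oneQubitGate B = twoQubitGate (kron4 A B) := by
  ext x y
  simp [oneQubitGate, twoQubitGate_eq, kron4, bitsEquiv, Matrix.kroneckerMap_apply]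

lemma oneQubitGate_mul_conjTranspose {A : Matrix (Fin 2) (Fin 2) ℂ} (hA : Aᴴ * A = 1) :
    oneQubitGate A * (oneQubitGate A)ᴴ = 1 := by
  rw [oneQubitGate, Matrix.conjTranspose_submatrix, Matrix.submatrix_mul_equiv,
    mul_eq_one_comm.1 hA, Matrix.submatrix_one_equiv]

lemma pauliString_eq (P : Fin 1 → Fin 4) : pauliString P = oneQubitGate (pauli (P 0)) := by
  ext x y
  simp [pauliString, oneQubitGate]

lemma kron4_eq (A B : Matrix (Fin 2) (Fin 2) ℂ) :
    kron4 A B = !![A 0 0 * B 0 0, A 0 0 * B 0 1, A 0 1 * B 0 0, A 0 1 * B 0 1;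
      A 0 0 * B 1 0, A 0 0 * B 1 1, A 0 1 * B 1 0, A 0 1 * B 1 1;
      A 1 0 * B 0 0, A 1 0 * B 0 1, A 1 1 * B 0 0, A 1 1 * B 0 1;
      A 1 0 * B 1 0, A 1 0 * B 1 1, A 1 1 * B 1 0, A 1 1 * B 1 1] := by
  ext i j
  fin_cases i <;> fin_cases j <;> rfl

lemma kron4_mul (A B C D : Matrix (Fin 2) (Fin 2) ℂ) :
    kron4 A B * kron4 C D = kron4 (A * C) (B * D) := by
  simp only [kron4, Matrix.reindex_apply, Matrix.submatrix_mul_equiv, Matrix.mul_kronecker_mul]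

/-- It suffices to know the images of the Pauli operators on each of the two qubits. -/
lemma mapsPauliToProduct_twoQubitGate {M : Matrix (Fin 4) (Fin 4) ℂ} (hM : Mᴴ * M = 1)
    (l₁ l₂ r₁ r₂ : Fin 4 → Fin 4) (s : Fin 4 → ℂ) (hs : ∀ q, star (s q) * s q = 1)
    (hl : ∀ q, M * kron4 (pauli q) 1 = kron4 (s q • pauli (l₁ q)) (pauli (l₂ q)) * M)
    (hr : ∀ q, M * kron4 1 (pauli q) = kron4 (s q • pauli (r₁ q)) (pauli (r₂ q)) * M) :
    MapsPauliToProduct (twoQubitGate M) := by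
  have hM' : M * Mᴴ = 1 := mul_eq_one_comm.1 hM
  have hu : ∀ q k, (s q • pauli k)ᴴ * (s q • pauli k) = 1 := by
    intro q k
    rw [Matrix.conjTranspose_smul, Matrix.smul_mul, Matrix.mul_smul, smul_smul, hs,
      conjTranspose_mul_pauli, one_smul]
  have hmul : ∀ {A B : Matrix (Fin 2) (Fin 2) ℂ}, Aᴴ * A = 1 → Bᴴ * B = 1 →
      (A * B)ᴴ * (A * B) = 1 := by
    intro A B hA hB
    rw [Matrix.conjTranspose_mul, mul_assoc, ← mul_assoc Aᴴ, hA, one_mul, hB]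
  intro P Q
  refine ⟨oneQubitGate ((s (P 0) • pauli (l₁ (P 0))) * (s (Q 0) • pauli (r₁ (Q 0)))),
    oneQubitGate (pauli (l₂ (P 0)) * pauli (r₂ (Q 0))),
    oneQubitGate_mul_conjTranspose (hmul (hu _ _) (hu _ _)),
    oneQubitGate_mul_conjTranspose (hmul (conjTranspose_mul_pauli _) (conjTranspose_mul_pauli _)),
    ?_⟩
  rw [pauliString_eq, pauliString_eq, oneQubitGate_kronecker, oneQubitGate_kronecker,
    twoQubitGate_conjTranspose, ← twoQubitGate_mul, ← twoQubitGate_mul]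
  congr 1
  -- `M` is moved past the two one-sided factors in turn.
  have h : kron4 (pauli (P 0)) (pauli (Q 0)) = kron4 (pauli (P 0)) 1 * kron4 1 (pauli (Q 0)) := by
    rw [kron4_mul, mul_one, one_mul]
  rw [h, ← mul_assoc, hl, mul_assoc _ M, hr, mul_assoc, mul_assoc, hM', mul_one, kron4_mul]

lemma bipartiteChoi_inducedMap
    (U : Matrix (Bits (Fin 1) × Bits (Fin 1)) (Bits (Fin 1) × Bits (Fin 1)) ℂ)
    (p q : (Bits (Fin 1) × Bits (Fin 1)) × (Bits (Fin 1) × Bits (Fin 1))) :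
    bipartiteChoi (inducedMap U) p q = (4 : ℂ)⁻¹ * (U (p.1.2, p.2.2) (p.1.1, p.2.1) *
      star (U (q.1.2, q.2.2) (q.1.1, q.2.1))) := by
  rw [bipartiteChoi_apply]
  have hc : (Fintype.card (Bits (Fin 1) × Bits (Fin 1)) : ℂ)⁻¹ = 4⁻¹ := by norm_num
  rw [hc]
  congr 1
  · change (U * Matrix.single (p.1.1, p.2.1) (q.1.1, q.2.1) 1 * Uᴴ : Matrix _ _ ℂ)
      (p.1.2, p.2.2) (q.1.2, q.2.2) = _
    rw [Matrix.mul_apply, Fintype.sum_eq_single (q.1.1, q.2.1)]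
    · simp [Matrix.mul_single_apply_same]
    · intro x hx
      rw [Matrix.mul_single_apply_of_ne _ _ _ _ _ hx, zero_mul]

lemma bits_cases (x : Bits (Fin 1)) : x = ![0] ∨ x = ![1] := by
  revert x
  decide

lemma sum_bits {M : Type*} [AddCommMonoid M] (f : Bits (Fin 1) → M) :
    ∑ x, f x = f ![0] + f ![1] := by
  rw [← Equiv.sum_comp (Equiv.funUnique (Fin 1) (Fin 2)).symm, Fin.sum_univ_two]
  congr 2 <;> ext i <;> fin_cases i <;> rfl

lemma twoQubitGate_apply (M : Matrix (Fin 4) (Fin 4) ℂ) (i j k l : Fin 2) :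
    twoQubitGate M (![i], ![j]) (![k], ![l])
      = M (![![0, 1], ![2, 3]] i j) (![![0, 1], ![2, 3]] k l) := by
  fin_cases i <;> fin_cases j <;> fin_cases k <;> fin_cases l <;> rfl

/-- If the partially transposed gate is unitary, then its Choi state is maximally entangled. -/
lemma gamma_SEP_eq_seven
    {U : Matrix (Bits (Fin 1) × Bits (Fin 1)) (Bits (Fin 1) × Bits (Fin 1)) ℂ}
    {F : Matrix (Bits (Fin 1) × Bits (Fin 1)) (Bits (Fin 1) × Bits (Fin 1)) ℂ}
    (hFU : ∀ p q, F q p = U (p.2, q.2) (p.1, q.1)) (hF : Fᴴ * F = 1) :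
    gamma (SEP (Bits (Fin 1) × Bits (Fin 1)) (Bits (Fin 1) × Bits (Fin 1)))
      (bipartiteChoi (inducedMap U)) = 7 := by
  -- The Schmidt index is the four-element basis of `AA'` itself, so the extent is `2 * 4 - 1`.
  have h : bipartiteChoi (inducedMap U) = schmidtState 1 F := by
    ext p q
    rw [bipartiteChoi_inducedMap, schmidtState]
    simp [schmidtVector, Matrix.vecMulVec_apply, Matrix.one_apply, hFU]
  rw [h, gamma_schmidtState (by simp) hF]
  simp
  norm_num

/-- CNOT is block diagonal in the control `t`, with blocks `1` and `X`. These are Hilbert–Schmidt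
orthogonal of norm `√2`, so the Choi vector has two equal Schmidt coefficients, and the extent is `2
* 2 - 1`. -/
lemma gamma_SEP_CNOT :
    gamma (SEP (Bits (Fin 1) × Bits (Fin 1)) (Bits (Fin 1) × Bits (Fin 1)))
      (bipartiteChoi (inducedMap CNOT)) = 3 := by
  let E : Matrix (Bits (Fin 1) × Bits (Fin 1)) (Bits (Fin 1)) ℂ :=
    Matrix.of fun p t => if p.1 = t ∧ p.2 = t then 1 else 0
  let F : Matrix (Bits (Fin 1) × Bits (Fin 1)) (Bits (Fin 1)) ℂ :=
    Matrix.of fun q t => (((√2)⁻¹ : ℝ) : ℂ) * CNOT (t, q.2) (t, q.1)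
  have hs : (((√2)⁻¹ : ℝ) : ℂ) * (((√2)⁻¹ : ℝ) : ℂ) = 2⁻¹ := by
    rw [← Complex.ofReal_mul, ← mul_inv, Real.mul_self_sqrt (by norm_num)]
    norm_num
  have hE : Eᴴ * E = 1 := by
    ext t t'
    rcases bits_cases t with rfl | rfl <;> rcases bits_cases t' with rfl | rfl <;>
      simp [E, Matrix.mul_apply, Fintype.sum_prod_type, sum_bits]
  have hF : Fᴴ * F = 1 := by
    ext t t'
    rcases bits_cases t with rfl | rfl <;> rcases bits_cases t' with rfl | rfl <;>
      simp [F, Matrix.mul_apply, Fintype.sum_prod_type, sum_bits, CNOT, twoQubitGate_apply]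
    all_goals
      rw [Complex.ofReal_inv] at hs
      rw [hs]
      norm_num
  have h : bipartiteChoi (inducedMap CNOT) = schmidtState E F := by
    have hφ : ∀ p, schmidtVector E F p =
        (((√2)⁻¹ : ℝ) : ℂ) * CNOT (p.1.2, p.2.2) (p.1.1, p.2.1) := by
      rintro ⟨⟨i, k⟩, ⟨j, l⟩⟩
      have hne : i ≠ k → CNOT (k, l) (i, j) = 0 := by
        rcases bits_cases i with rfl | rfl <;> rcases bits_cases j with rfl | rfl <;>
        rcases bits_cases k with rfl | rfl <;> rcases bits_cases l with rfl | rfl <;>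
          simp [CNOT, twoQubitGate_apply]
      by_cases hik : i = k
      · subst hik
        simp [schmidtVector, E, F]
      · rw [hne hik]
        refine (Finset.sum_eq_zero fun t _ => ?_).trans (mul_zero _).symm
        have : ¬(i = t ∧ k = t) := fun h => hik (h.1.trans h.2.symm)
        simp [E, this]
    ext p q
    rw [bipartiteChoi_inducedMap, schmidtState, Matrix.smul_apply, Matrix.vecMulVec_apply,
      Pi.star_apply, hφ, hφ, star_mul', Complex.star_def, Complex.conj_ofReal, mul_mul_mul_comm, hs]
    simp
    ring
  rw [h, gamma_schmidtState hE hF]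
  norm_num

lemma gamma_SEP_SWAP :
    gamma (SEP (Bits (Fin 1) × Bits (Fin 1)) (Bits (Fin 1) × Bits (Fin 1)))
      (bipartiteChoi (inducedMap SWAP)) = 7 := by
  refine gamma_SEP_eq_seven (F := Matrix.of fun q p => SWAP (p.2, q.2) (p.1, q.1))
    (fun _ _ => rfl) ?_
  ext ⟨i, k⟩ ⟨i', k'⟩
  rcases bits_cases i with rfl | rfl <;> rcases bits_cases k with rfl | rfl <;>
  rcases bits_cases i' with rfl | rfl <;> rcases bits_cases k' with rfl | rfl <;>
    simp [Matrix.mul_apply, Fintype.sum_prod_type, sum_bits, SWAP, twoQubitGate_apply]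

lemma gamma_SEP_iSWAP :
    gamma (SEP (Bits (Fin 1) × Bits (Fin 1)) (Bits (Fin 1) × Bits (Fin 1)))
      (bipartiteChoi (inducedMap iSWAP)) = 7 := by
  refine gamma_SEP_eq_seven (F := Matrix.of fun q p => iSWAP (p.2, q.2) (p.1, q.1))
    (fun _ _ => rfl) ?_
  ext ⟨i, k⟩ ⟨i', k'⟩
  rcases bits_cases i with rfl | rfl <;> rcases bits_cases k with rfl | rfl <;>
  rcases bits_cases i' with rfl | rfl <;> rcases bits_cases k' with rfl | rfl <;>
    simp [Matrix.mul_apply, Fintype.sum_prod_type, sum_bits, iSWAP, twoQubitGate_apply]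

lemma gamma_LOCCStar_twoQubitGate {M : Matrix (Fin 4) (Fin 4) ℂ} (hM : Mᴴ * M = 1)
    (hP : MapsPauliToProduct (twoQubitGate M)) :
    gamma (LOCCStar (Bits (Fin 1)) (Bits (Fin 1))) (inducedMap (twoQubitGate M)) =
      gamma (SEP (Bits (Fin 1) × Bits (Fin 1)) (Bits (Fin 1) × Bits (Fin 1)))
        (bipartiteChoi (inducedMap (twoQubitGate M))) := by
  have hU : (twoQubitGate M)ᴴ * twoQubitGate M = 1 := by
    rw [twoQubitGate_conjTranspose, ← twoQubitGate_mul, hM, twoQubitGate_one]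
  have h := gamma_LOCCStar_eq_gamma_SEP hU hP
  exact h.1.trans h.2

/-! ### Pauli images under the three gates -/

theorem gamma_LOCCStar_CNOT :
    gamma (LOCCStar (Bits (Fin 1)) (Bits (Fin 1))) (inducedMap CNOT) = 3 := by
  rw [← gamma_SEP_CNOT]
  have hM : (!![1, 0, 0, 0; 0, 1, 0, 0; 0, 0, 0, 1; 0, 0, 1, 0] : Matrix (Fin 4) (Fin 4) ℂ)ᴴ *
      !![1, 0, 0, 0; 0, 1, 0, 0; 0, 0, 0, 1; 0, 0, 1, 0] = 1 := by
    ext i j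
    fin_cases i <;> fin_cases j <;> simp [Matrix.mul_apply, Fin.sum_univ_four]
  -- `X` and `Y` on the control pick up an `X` on the target; `Y` and `Z` on the target pick up a
  -- `Z` on the control.
  refine gamma_LOCCStar_twoQubitGate hM (mapsPauliToProduct_twoQubitGate hM
    ![0, 1, 2, 3] ![0, 1, 1, 0] ![0, 0, 3, 3] ![0, 1, 2, 3] (fun _ => 1) (by simp) ?_ ?_)
  all_goals
    intro q
    fin_cases q <;> simp [pauli, kron4_eq]

theorem gamma_LOCCStar_SWAP :
    gamma (LOCCStar (Bits (Fin 1)) (Bits (Fin 1))) (inducedMap SWAP) = 7 := by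
  rw [← gamma_SEP_SWAP]
  have hM : (!![1, 0, 0, 0; 0, 0, 1, 0; 0, 1, 0, 0; 0, 0, 0, 1] : Matrix (Fin 4) (Fin 4) ℂ)ᴴ *
      !![1, 0, 0, 0; 0, 0, 1, 0; 0, 1, 0, 0; 0, 0, 0, 1] = 1 := by
    ext i j
    fin_cases i <;> fin_cases j <;> simp [Matrix.mul_apply, Fin.sum_univ_four]
  refine gamma_LOCCStar_twoQubitGate hM (mapsPauliToProduct_twoQubitGate hM
    0 id id 0 (fun _ => 1) (by simp) ?_ ?_)
  all_goals
    intro q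
    fin_cases q <;> simp [pauli, kron4_eq]

theorem gamma_LOCCStar_iSWAP :
    gamma (LOCCStar (Bits (Fin 1)) (Bits (Fin 1))) (inducedMap iSWAP) = 7 := by
  rw [← gamma_SEP_iSWAP]
  have hM : (!![1, 0, 0, 0; 0, 0, Complex.I, 0; 0, Complex.I, 0, 0; 0, 0, 0, 1] :
      Matrix (Fin 4) (Fin 4) ℂ)ᴴ *
        !![1, 0, 0, 0; 0, 0, Complex.I, 0; 0, Complex.I, 0, 0; 0, 0, 0, 1] = 1 := by
    ext i j
    fin_cases i <;> fin_cases j <;> simp [Matrix.mul_apply, Fin.sum_univ_four]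
  -- `X ⊗ 1` goes to `Z ⊗ Y`, `Y ⊗ 1` to `-(Z ⊗ X)` and `Z ⊗ 1` to `1 ⊗ Z`, and symmetrically for
  -- the other qubit; hence the sign at `Y`.
  refine gamma_LOCCStar_twoQubitGate hM (mapsPauliToProduct_twoQubitGate hM
    ![0, 3, 3, 0] ![0, 2, 1, 3] ![0, 2, 1, 3] ![0, 3, 3, 0] ![1, 1, -1, 1] (fun q => ?_) ?_ ?_)
  · fin_cases q <;> simp
  all_goals
    intro q
    fin_cases q <;> simp [pauli, kron4_eq]

end Gates

end CircuitKnitting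

end

theorem mainTheorem9 :
    (∀ (n m : ℕ)
      (U : Matrix (Bits (Fin n) × Bits (Fin m)) (Bits (Fin n) × Bits (Fin m)) ℂ),
      IsBipartiteClifford U →
        gamma (LOCCStar (Bits (Fin n)) (Bits (Fin m))) (inducedMap U)
          = gamma (LOCC (Bits (Fin n)) (Bits (Fin m))) (inducedMap U) ∧
        gamma (LOCC (Bits (Fin n)) (Bits (Fin m))) (inducedMap U)
          = gamma (SEP (Bits (Fin n) × Bits (Fin n)) (Bits (Fin m) × Bits (Fin m)))
              (bipartiteChoi (inducedMap U))) ∧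
    gamma (LOCCStar (Bits (Fin 1)) (Bits (Fin 1))) (inducedMap CNOT) = 3 ∧
    gamma (LOCCStar (Bits (Fin 1)) (Bits (Fin 1))) (inducedMap SWAP) = 7 ∧
    gamma (LOCCStar (Bits (Fin 1)) (Bits (Fin 1))) (inducedMap iSWAP) = 7 := by
  refine ⟨fun n m U hU => ?_, gamma_LOCCStar_CNOT, gamma_LOCCStar_SWAP, gamma_LOCCStar_iSWAP⟩
  exact gamma_LOCCStar_eq_gamma_SEP hU.conjTranspose_mul_self hU.mapsPauliToProduct
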